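/- **Setting.** Let $p\ge 1$ and $-1\le k\le p-2$ be integers, let $T\ge 0$, let $0=\xi_0<\xi_1<\dots<\xi_T<\xi_{T+1}=1$, $\Xi=\{\xi_1,\dots,\xi_T\}$, and let $S=(s_1,\dots,s_T)$ with integers $-1\le s_i\le p-1$. Write $\mathcal P_p$ for the polynomials of degree at most $p$, $\|\cdot\|$ for the norm of $L^2(0,1)$, and $C^{-1}$ for the absence of any smoothness condition. The broken Sobolev space is $$\mathfrak H^{p+1}(\Xi,S)=\{f\in L^2(0,1):\ \partial^{p+1}f\in L^2(\xi_i,\xi_{i+1}),\ 0\le i\le T;\ \ \partial^{s_i+1}f\in L^2(\xi_{i-1},\xi_{i+1}),\ 1\le i\le T\}$$ (weak derivatives), with $\|\partial^{p+1}f\|_\Xi=\big(\sum_{i=0}^T\|\partial^{p+1}f\|^2_{L^2(\xi_i,\xi_{i+1})}\big)^{1/2}$. For an integer $\kappa$ with $-1\le\kappa\le p-1$ and an integer $n\ge1$ let $$\mathcal S_{p,\kappa,n}=\{f\in C^\kappa([0,1]): f|_{[j/n,(j+1)/n)}\in\mathcal P_p,\ 0\le j\le n-1\},$$ $$\mathfrak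 J^p_\kappa(\Xi,S)=\{f: f|_{(\xi_i,\xi_{i+1})}\in\mathcal P_p\ (0\le i\le T),\ f\in C^{\min\{\kappa,s_i\}}(\xi_{i-1},\xi_{i+1})\ (1\le i\le T)\},$$ $\mathfrak S_{p,\kappa,n}=\mathcal S_{p,\kappa,n}+\mathfrak J^p_\kappa(\Xi,S)\subset L^2(0,1)$, let $\mathfrak P_{p,\kappa,n}$ be the $L^2(0,1)$-orthogonal projection onto $\mathfrak S_{p,\kappa,n}$, and let $\mathfrak C_{p,\kappa,n}$ be the smallest constant such that $$\|f-\mathfrak P_{p,\kappa,n}f\|\le\mathfrak C_{p,\kappa,n}\|\partial^{p+1}f\|_\Xi\qquad\text{for all } f\in\mathfrak H^{p+1}(\Xi,S).$$ For $n\ge 1$ let $\sigma_i=p-\min\{k,s_i\}$ if $\xi_i\notin\{j/n: 1\le j\le n-1\}$ and $\sigma_i=\max\{k-s_i,0\}$ otherwise (so $\sigma_i$ depends on $n$), and let $$R_{p,k,n}=\Big(\frac{4}{e\pi}\,\frac{n(p+1)}{(p-k)(n-1)+1}\Big)^{p+1}\sqrt{4p+6}.$$ **Theorem.** Suppose $R_{p,k,\bar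 n}<1$ for some integer $\bar n\ge1$. Then for every integer $n\ge1$ with $$n\ge\Big(1+\frac{T(p-k)-\sum_{i=1}^T(\sigma_i+s_i-p)}{p-k-1}\Big)\bar n-T,$$ the integer $$m=(n-1)(p-k)+1+\sum_{i=1}^T(\sigma_i+s_i-p)$$ is at least $1$, the smallest constants $\mathfrak C_{p,p-1,m}$ and $\mathfrak C_{p,k,n}$ exist, and $$\mathfrak C_{p,p-1,m}<\mathfrak C_{p,k,n}.$$ -/

import Mathlib

open MeasureTheory Polynomial
open scoped ContDiff

noncomputable section

namespace BrokenSpline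

/-- Lebesgue measure on `(0,1)`. -/
abbrev unitMeasure : Measure ℝ := volume.restrict (Set.Ioo (0 : ℝ) 1)

/-- The Hilbert space `L²(0,1)`. -/
abbrev L2 : Type := Lp ℝ 2 unitMeasure

/-- `f ∈ C^k(U)` for an integer `k ≥ -1`; for `k = -1` there is no condition. -/
def IsC (k : ℤ) (f : ℝ → ℝ) (U : Set ℝ) : Prop :=
  0 ≤ k → ContDiffOn ℝ (k.toNat : WithTop ℕ∞) f U

/-- On the set `U`, the function `f` is a polynomial of degree at most `p`. -/
def IsPolyOn (p : ℕ) (f : ℝ → ℝ) (U : Set ℝ) : Prop :=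
  ∃ P : ℝ[X], P.natDegree ≤ p ∧ ∀ x ∈ U, f x = P.eval x

theorem IsC.add {k : ℤ} {f g : ℝ → ℝ} {U : Set ℝ} (hf : IsC k f U) (hg : IsC k g U) :
    IsC k (f + g) U := fun h => (hf h).add (hg h)

theorem IsC.smul {k : ℤ} {f : ℝ → ℝ} {U : Set ℝ} (c : ℝ) (hf : IsC k f U) :
    IsC k (c • f) U := fun h => (hf h).const_smul c

theorem IsC.zero (k : ℤ) (U : Set ℝ) : IsC k 0 U := fun _ => contDiffOn_const (c := (0 : ℝ))

theorem IsPolyOn.add {p : ℕ} {f g : ℝ → ℝ} {U : Set ℝ} (hf : IsPolyOn p f U)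
    (hg : IsPolyOn p g U) : IsPolyOn p (f + g) U := by
  obtain ⟨P, hP, hPf⟩ := hf
  obtain ⟨Q, hQ, hQg⟩ := hg
  refine ⟨P + Q, natDegree_add_le_of_degree_le hP hQ, fun x hx => ?_⟩
  simp [hPf x hx, hQg x hx]

theorem IsPolyOn.smul {p : ℕ} {f : ℝ → ℝ} {U : Set ℝ} (c : ℝ) (hf : IsPolyOn p f U) :
    IsPolyOn p (c • f) U := by
  obtain ⟨P, hP, hPf⟩ := hf
  refine ⟨c • P, (natDegree_smul_le c P).trans hP, fun x hx => ?_⟩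
  simp [hPf x hx]

theorem IsPolyOn.zero (p : ℕ) (U : Set ℝ) : IsPolyOn p 0 U := ⟨0, by simp, by simp⟩

/-- Breakpoints `0 = ξ₀ < ξ₁ < ⋯ < ξ_T < ξ_{T+1} = 1`. -/
structure Breakpoints (T : ℕ) where
  pt : Fin (T + 2) → ℝ
  strictMono : StrictMono pt
  first : pt 0 = 0
  last : pt (Fin.last (T + 1)) = 1

/-- The open piece `(ξ_i, ξ_{i+1})`, for `i = 0, …, T`. -/
def Breakpoints.piece {T : ℕ} (ξ : Breakpoints T) (i : Fin (T + 1)) : Set ℝ :=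
  Set.Ioo (ξ.pt i.castSucc) (ξ.pt i.succ)

/-- The `i`-th interior breakpoint; `i : Fin T` stands for the index `i + 1` in `1, …, T`. -/
def Breakpoints.interior {T : ℕ} (ξ : Breakpoints T) (i : Fin T) : ℝ :=
  ξ.pt i.succ.castSucc

/-- The left neighbour of the `i`-th interior breakpoint. -/
def Breakpoints.left {T : ℕ} (ξ : Breakpoints T) (i : Fin T) : ℝ :=
  ξ.pt i.castSucc.castSucc

/-- The right neighbour of the `i`-th interior breakpoint. -/
def Breakpoints.right {T : ℕ} (ξ : Breakpoints T) (i : Fin T) : ℝ :=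
  ξ.pt i.succ.succ

/-- The segment `I_j = [j/n, (j+1)/n)`. -/
def segment (n : ℕ+) (j : Fin n) : Set ℝ :=
  Set.Ico ((j : ℝ) / (n : ℝ)) (((j : ℝ) + 1) / (n : ℝ))

/-- The splines of degree `p`, smoothness `k`, on `n` uniform segments. -/
def splineFun (p : ℕ) (k : ℤ) (n : ℕ+) : Submodule ℝ (ℝ → ℝ) where
  carrier := {f | IsC k f (Set.Icc 0 1) ∧ ∀ j : Fin n, IsPolyOn p f (segment n j)}
  add_mem' hf hg := ⟨hf.1.add hg.1, fun j => (hf.2 j).add (hg.2 j)⟩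
  zero_mem' := ⟨IsC.zero _ _, fun _ => IsPolyOn.zero _ _⟩
  smul_mem' c _ hf := ⟨hf.1.smul c, fun j => (hf.2 j).smul c⟩

/-- The enrichment space: functions that are polynomials of degree at most `p` on every piece
`(ξ_i, ξ_{i+1})` and of class `C^{min(k, s_i)}` on `(ξ_{i-1}, ξ_{i+1})`. -/
def jumpFun (p : ℕ) (k : ℤ) {T : ℕ} (ξ : Breakpoints T) (s : Fin T → ℤ) :
    Submodule ℝ (ℝ → ℝ) where
  carrier := {f | (∀ i, IsPolyOn p f (ξ.piece i)) ∧
    ∀ i, IsC (min k (s i)) f (Set.Ioo (ξ.left i) (ξ.right i))}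
  add_mem' hf hg := ⟨fun i => (hf.1 i).add (hg.1 i), fun i => (hf.2 i).add (hg.2 i)⟩
  zero_mem' := ⟨fun _ => IsPolyOn.zero _ _, fun _ => IsC.zero _ _⟩
  smul_mem' c _ hf := ⟨fun i => (hf.1 i).smul c, fun i => (hf.2 i).smul c⟩

/-- The subspace of `L²(0,1)` formed by the classes of the functions in `V`. -/
def classes (V : Submodule ℝ (ℝ → ℝ)) : Submodule ℝ L2 where
  carrier := {u | ∃ f ∈ V, (u : ℝ → ℝ) =ᵐ[unitMeasure] f}
  add_mem' := by
    rintro u v ⟨f, hf, huf⟩ ⟨g, hg, hvg⟩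
    exact ⟨f + g, V.add_mem hf hg, (Lp.coeFn_add u v).trans (huf.add hvg)⟩
  zero_mem' := ⟨0, V.zero_mem, Lp.coeFn_zero ℝ 2 unitMeasure⟩
  smul_mem' := by
    rintro c u ⟨f, hf, huf⟩
    exact ⟨c • f, V.smul_mem c hf, (Lp.coeFn_smul c u).trans (huf.const_smul c)⟩

/-- The enriched spline space, a subspace of `L²(0,1)`. -/
def brokenSpline (p : ℕ) (k : ℤ) (n : ℕ+) {T : ℕ} (ξ : Breakpoints T) (s : Fin T → ℤ) :
    Submodule ℝ L2 :=
  classes (splineFun p k n) ⊔ classes (jumpFun p k ξ s)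

theorem memLp_monomial {A : Set ℝ} (hA : MeasurableSet A) (d : ℕ) :
    MemLp (A.indicator fun x : ℝ => x ^ d) 2 unitMeasure := by
  refine MemLp.indicator hA (MemLp.of_bound (by fun_prop) 1 ?_)
  filter_upwards [ae_restrict_mem measurableSet_Ioo] with x hx
  rw [norm_pow, Real.norm_of_nonneg hx.1.le]
  exact pow_le_one₀ hx.1.le hx.2.le

theorem finiteDimensional_classes {ι : Type} [Fintype ι] (V : Submodule ℝ (ℝ → ℝ))
    (A : ι → Set ℝ) (hA : ∀ i, MeasurableSet (A i)) (hd : ∀ i j, ∀ x ∈ A i, x ∈ A j → i = j)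
    (hc : ∀ᵐ x ∂unitMeasure, ∃ i, x ∈ A i) (p : ℕ) (hV : ∀ f ∈ V, ∀ i, IsPolyOn p f (A i)) :
    FiniteDimensional ℝ (classes V) := by
  classical
  let e : ι × Fin (p + 1) → L2 := fun z => (memLp_monomial (hA z.1) z.2).toLp _
  have hfin : FiniteDimensional ℝ (Submodule.span ℝ (Set.range e)) :=
    FiniteDimensional.span_of_finite ℝ (Set.finite_range e)
  refine Submodule.finiteDimensional_of_le (S₂ := Submodule.span ℝ (Set.range e)) ?_
  rintro u ⟨f, hf, huf⟩
  choose P hP hPf using hV f hf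
  have key : u = ∑ z : ι × Fin (p + 1), (P z.1).coeff z.2 • e z := by
    apply Lp.ext
    have h1 : ∀ᵐ x ∂unitMeasure, ∀ z, (e z : ℝ → ℝ) x
        = (A z.1).indicator (fun x : ℝ => x ^ (z.2 : ℕ)) x :=
      ae_all_iff.2 fun z => (memLp_monomial (hA z.1) z.2).coeFn_toLp
    have h2 : ∀ᵐ x ∂unitMeasure, ∀ z : ι × Fin (p + 1),
        (((P z.1).coeff z.2 • e z : L2) : ℝ → ℝ) x = (P z.1).coeff z.2 * (e z : ℝ → ℝ) x :=
      ae_all_iff.2 fun z => Lp.coeFn_smul _ (e z)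
    have h3 := Lp.coeFn_finsetSum (μ := unitMeasure) (p := 2) Finset.univ
      (fun z : ι × Fin (p + 1) => (P z.1).coeff z.2 • e z)
    filter_upwards [huf, h1, h2, h3, hc] with x hx h1 h2 h3 hc
    obtain ⟨i, hi⟩ := hc
    rw [hx, h3, hPf i x hi, Finset.sum_apply, Fintype.sum_prod_type, Finset.sum_eq_single i]
    · rw [eval_eq_sum_range' (Nat.lt_succ_of_le (hP i)), ← Fin.sum_univ_eq_sum_range
        (fun d => (P i).coeff d * x ^ d)]
      refine Finset.sum_congr rfl fun d _ => ?_
      rw [h2, h1, Set.indicator_of_mem hi]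
    · intro j _ hj
      refine Finset.sum_eq_zero fun d _ => ?_
      rw [h2, h1, Set.indicator_of_notMem (fun h => hj (hd j i x h hi)), mul_zero]
    · simp
  rw [key]
  exact Submodule.sum_mem _ fun z _ =>
    Submodule.smul_mem _ _ (Submodule.subset_span (Set.mem_range_self z))

instance (p : ℕ) (k : ℤ) (n : ℕ+) : FiniteDimensional ℝ (classes (splineFun p k n)) := by
  have hn : (0 : ℝ) < (n : ℝ) := by exact_mod_cast n.pos
  have hlt : ∀ i j : Fin n, ∀ x ∈ segment n i, x ∈ segment n j → (i : ℕ) < j + 1 := by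
    intro i j x hi hj
    have := (div_lt_div_iff_of_pos_right hn).1 (hi.1.trans_lt hj.2)
    exact_mod_cast this
  refine finiteDimensional_classes _ (segment n) (fun _ => measurableSet_Ico) ?_ ?_ p
    (fun f hf => hf.2)
  · intro i j x hi hj
    have h1 := hlt i j x hi hj
    have h2 := hlt j i x hj hi
    exact Fin.ext (by omega)
  · filter_upwards [ae_restrict_mem measurableSet_Ioo] with x hx
    have hx0 : 0 ≤ x * n := mul_nonneg hx.1.le hn.le
    refine ⟨⟨⌊x * n⌋₊, (Nat.floor_lt hx0).2 (by nlinarith [hx.2])⟩, ?_, ?_⟩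
    · exact (div_le_iff₀ hn).2 (Nat.floor_le hx0)
    · exact (lt_div_iff₀ hn).2 (Nat.lt_floor_add_one _)

instance (p : ℕ) (k : ℤ) {T : ℕ} (ξ : Breakpoints T) (s : Fin T → ℤ) :
    FiniteDimensional ℝ (classes (jumpFun p k ξ s)) := by
  have hle : ∀ i j : Fin (T + 1), ∀ x ∈ ξ.piece i, x ∈ ξ.piece j → i ≤ j := by
    intro i j x hi hj
    have := ξ.strictMono.lt_iff_lt.1 (hi.1.trans hj.2)
    exact Fin.castSucc_lt_succ_iff.1 this
  refine finiteDimensional_classes _ ξ.piece (fun _ => measurableSet_Ioo) ?_ ?_ p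
    (fun f hf => hf.1)
  · intro i j x hi hj
    exact le_antisymm (hle i j x hi hj) (hle j i x hj hi)
  · have hnull : ∀ᵐ x ∂unitMeasure, x ∉ Set.range ξ.pt :=
      ae_restrict_of_ae ((Set.finite_range ξ.pt).countable.ae_notMem volume)
    filter_upwards [ae_restrict_mem measurableSet_Ioo, hnull] with x hx hr
    by_contra! hno
    have h : ∀ i : Fin (T + 2), ξ.pt i < x := by
      intro i
      induction i using Fin.induction with
      | zero => rw [ξ.first]; exact hx.1
      | succ i ih =>
        by_contra! hi
        exact hno i ⟨ih, lt_of_le_of_ne hi fun h => hr ⟨_, h.symm⟩⟩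
    have := h (Fin.last (T + 1))
    rw [ξ.last] at this
    exact lt_asymm this hx.2

instance (p : ℕ) (k : ℤ) (n : ℕ+) {T : ℕ} (ξ : Breakpoints T) (s : Fin T → ℤ) :
    FiniteDimensional ℝ (brokenSpline p k n ξ s) := by
  unfold brokenSpline
  infer_instance

/-- The orthogonal projection of `L²(0,1)` onto the enriched spline space. -/
def brokenProj (p : ℕ) (k : ℤ) (n : ℕ+) {T : ℕ} (ξ : Breakpoints T) (s : Fin T → ℤ) :
    L2 →L[ℝ] L2 :=
  (brokenSpline p k n ξ s).starProjection

/-- `g` is in `L²(a,b)` and is the weak derivative of order `r` of `f` on `(a,b)`. -/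
def IsWeakDeriv (r : ℕ) (a b : ℝ) (f g : ℝ → ℝ) : Prop :=
  MemLp g 2 (volume.restrict (Set.Ioo a b)) ∧
  ∀ φ : ℝ → ℝ, ContDiff ℝ ∞ φ → HasCompactSupport φ → tsupport φ ⊆ Set.Ioo a b →
    ∫ x in Set.Ioo a b, f x * iteratedDeriv r φ x = (-1) ^ r * ∫ x in Set.Ioo a b, g x * φ x

/-- The broken Sobolev space: `∂^{p+1} f ∈ L²(ξ_i, ξ_{i+1})` for `i = 0, …, T` and
`∂^{s_i+1} f ∈ L²(ξ_{i-1}, ξ_{i+1})` for `i = 1, …, T`. -/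
def brokenSobolev (p : ℕ) {T : ℕ} (ξ : Breakpoints T) (s : Fin T → ℤ) : Set L2 :=
  {f | (∀ i : Fin (T + 1), ∃ g, IsWeakDeriv (p + 1) (ξ.pt i.castSucc) (ξ.pt i.succ) f g) ∧
    ∀ i : Fin T, ∃ g, IsWeakDeriv (s i + 1).toNat (ξ.left i) (ξ.right i) f g}

/-- `g` is the piecewise weak derivative of order `r` of `f`. -/
def IsBrokenDeriv (r : ℕ) {T : ℕ} (ξ : Breakpoints T) (f g : ℝ → ℝ) : Prop :=
  ∀ i : Fin (T + 1), IsWeakDeriv r (ξ.pt i.castSucc) (ξ.pt i.succ) f g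

/-- The piecewise `L²` norm. -/
def brokenNorm {T : ℕ} (ξ : Breakpoints T) (g : ℝ → ℝ) : ℝ :=
  √(∑ i : Fin (T + 1), (eLpNorm g 2 (volume.restrict (ξ.piece i))).toReal ^ 2)

/-- The constants `C` for which `‖f - 𝔓 f‖ ≤ C ‖∂^{p+1} f‖_Ξ` on the broken Sobolev space. -/
def admissible (p : ℕ) (k : ℤ) (n : ℕ+) {T : ℕ} (ξ : Breakpoints T) (s : Fin T → ℤ) : Set ℝ :=
  {C | ∀ f ∈ brokenSobolev p ξ s, ∀ g : ℝ → ℝ, IsBrokenDeriv (p + 1) ξ f g →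
    ‖f - brokenProj p k n ξ s f‖ ≤ C * brokenNorm ξ g}

/-- The best constant for the enriched spline space. -/
def brokenConst (p : ℕ) (k : ℤ) (n : ℕ+) {T : ℕ} (ξ : Breakpoints T) (s : Fin T → ℤ) : ℝ :=
  sInf (admissible p k n ξ s)

open Classical in
/-- The number `σ_i`. -/
def sigma (p : ℕ) (k : ℤ) (n : ℕ+) {T : ℕ} (ξ : Breakpoints T) (s : Fin T → ℤ)
    (i : Fin T) : ℤ :=
  if ∃ j : ℕ, 1 ≤ j ∧ j < (n : ℕ) ∧ ξ.interior i = (j : ℝ) / (n : ℝ) then max (k - s i) 0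
  else (p : ℤ) - min k (s i)

/-- The sum of `σ_i + s_i - p` over `i = 1, …, T`. -/
def excess (p : ℕ) (k : ℤ) (n : ℕ+) {T : ℕ} (ξ : Breakpoints T) (s : Fin T → ℤ) : ℤ :=
  ∑ i : Fin T, (sigma p k n ξ s i + s i - p)

/-- The number of segments chosen for the maximally smooth space. -/
def smoothSegments (p : ℕ) (k : ℤ) (n : ℕ+) {T : ℕ} (ξ : Breakpoints T) (s : Fin T → ℤ) : ℤ :=
  ((n : ℤ) - 1) * (p - k) + 1 + excess p k n ξ s

/-- The number `B_{p,k,n}`. -/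
def B (p : ℕ) (k : ℤ) (n : ℕ+) : ℝ :=
  4 / (Real.exp 1 * Real.pi) * ((n : ℝ) * (p + 1) / (((p : ℝ) - k) * ((n : ℝ) - 1) + 1))

/-- The number `R_{p,k,n}`. -/
def R (p : ℕ) (k : ℤ) (n : ℕ+) : ℝ :=
  B p k n ^ (p + 1) * √(4 * (p : ℝ) + 6)

end BrokenSpline

end

/-!
# Maximally smooth splines beat splines of lower smoothness

The constant of the maximally smooth space is bounded from above, the one of the space of lower
smoothness from below, and the two bounds are compared.

*Upper bound.* Let `K u = ∫₀ˣ u` on `L²(0,1)`. Integration by parts says `K + K* = ⟪1, ·⟫ 1`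
(`inner_integralOp_add`). If `V_p` denotes the maximally smooth splines of degree `p` on `m` uniform
segments, then `1 ∈ V_p` and `K V_p ⊆ V_{p+1}`, and passing to adjoints shows that
`‖(1 - P_{p+1}) K‖ ≤ ‖(1 - P_p) K‖`. Hence all these norms are at most the one for step functions,
which is `1 / (m π)` by Poincaré's inequality with its sharp constant
(`norm_integralOp_le_of_orthogonal`), and `(p+1)`-fold integrals of `g` are approximated with error
at most `(1 / (m π))^(p+1) ‖g‖` (`norm_projError_smoothSplines_le`). An element `f` of the broken
Sobolev space is the `(p+1)`-fold integral of its piecewise derivative plus an element of the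
enrichment space (`sub_iterate_mem_classes_jumpFun`, by the lemma of du Bois-Reymond), so the same
bound holds for the enriched space: `pow_mem_admissible`.

*Lower bound.* Elements of the enriched space with `n` segments and `T` breakpoints are piecewise
polynomials of degree `p` on at most `n + T` intervals. For `f = x^(p+1)` the error on each of these
is at least the norm of the monic Legendre polynomial, and the sum is smallest for equal lengths.
This gives `le_of_mem_admissible`.

*Comparison.* By Stirling's formula (`factorial_two_mul_le`) the upper bound is smaller than the
lower one if `(4 / (e π) · (n + T) (p + 1) / m)^(p+1) √(4p+6) < 1`, and the hypothesis on `n` says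
that `(n + T) / m` is at most the corresponding ratio in `R p k nbar`.
-/

noncomputable section

namespace BrokenSpline

/-! ### An abstract induction on the smoothness -/

section Abstract

variable {H : Type*} [NormedAddCommGroup H] [InnerProductSpace ℝ H]

/-- The orthogonal projection onto the complement of `V`. -/
abbrev projError (V : Submodule ℝ H) [V.HasOrthogonalProjection] : H →L[ℝ] H :=
  1 - V.starProjection

theorem projError_apply (V : Submodule ℝ H) [V.HasOrthogonalProjection] (u : H) :
    projError V u = u - V.starProjection u := rfl

theorem projError_mem_orthogonal (V : Submodule ℝ H) [V.HasOrthogonalProjection] (u : H) :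
    projError V u ∈ Vᗮ := V.sub_starProjection_mem_orthogonal u

theorem norm_projError_le (V : Submodule ℝ H) [V.HasOrthogonalProjection] (u : H) {v : H}
    (hv : v ∈ V) : ‖projError V u‖ ≤ ‖u - v‖ := by
  rw [projError_apply, Submodule.starProjection_minimal]
  exact ciInf_le ⟨0, by rintro _ ⟨w, rfl⟩; positivity⟩ (⟨v, hv⟩ : V)

/-- Here `K + K*` is the rank one operator `⟪e, ·⟫ e`, so that `K* = -K` on the complement of
`e`. -/
theorem apply_mem_orthogonal {K : H →L[ℝ] H} {e : H}
    (hK : ∀ u v, inner ℝ (K u) v + inner ℝ u (K v) = inner ℝ e u * inner ℝ e v)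
    {V W : Submodule ℝ H} (heW : e ∈ W) (hVW : ∀ v ∈ V, K v ∈ W) {w : H} (hw : w ∈ Wᗮ) :
    K w ∈ Vᗮ := fun v hv => by
  have h := hK v w
  rw [show inner ℝ e w = 0 from hw e heW, mul_zero, hw _ (hVW v hv), zero_add] at h
  exact h

/-- A bound for `K` on the complement of `V` carries over to the complement of a space `W` that
contains `K V`: for `w` in the latter, `‖K w‖² = -⟪K (K w), w⟫`, and `K w` is orthogonal to `V`. -/
theorem norm_apply_le_of_mem_orthogonal {K : H →L[ℝ] H} {e : H}
    (hK : ∀ u v, inner ℝ (K u) v + inner ℝ u (K v) = inner ℝ e u * inner ℝ e v)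
    {V W : Submodule ℝ H} (heW : e ∈ W) (hVW : ∀ v ∈ V, K v ∈ W) {c : ℝ} (hc : 0 ≤ c)
    (hV : ∀ v ∈ Vᗮ, ‖K v‖ ≤ c * ‖v‖) {w : H} (hw : w ∈ Wᗮ) : ‖K w‖ ≤ c * ‖w‖ := by
  have hew : inner ℝ e w = 0 := hw e heW
  have hKw : K w ∈ Vᗮ := apply_mem_orthogonal hK heW hVW hw
  have h1 := hK (K w) w
  rw [hew, mul_zero] at h1
  have h2 : ‖K w‖ ^ 2 ≤ c * ‖K w‖ * ‖w‖ := by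
    rw [← real_inner_self_eq_norm_sq]
    calc inner ℝ (K w) (K w) = -inner ℝ (K (K w)) w := by linarith
      _ ≤ ‖K (K w)‖ * ‖w‖ := by
        rw [← inner_neg_left, ← norm_neg (K (K w))]; exact real_inner_le_norm _ _
      _ ≤ c * ‖K w‖ * ‖w‖ := by gcongr; exact hV _ hKw
  rcases (norm_nonneg (K w)).eq_or_lt with h | h
  · rw [← h]; positivity
  · nlinarith

/-- Duality: a bound for `K` on the complement of `W` bounds the error of `W` on the range of `K`.
The error of `V` on the right-hand side makes the estimate iterate. -/
theorem norm_projError_apply_le {K : H →L[ℝ] H} {e : H}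
    (hK : ∀ u v, inner ℝ (K u) v + inner ℝ u (K v) = inner ℝ e u * inner ℝ e v)
    {V W : Submodule ℝ H} [V.HasOrthogonalProjection] [W.HasOrthogonalProjection]
    (heW : e ∈ W) (hVW : ∀ v ∈ V, K v ∈ W) {c : ℝ} (hc : 0 ≤ c)
    (hW : ∀ w ∈ Wᗮ, ‖K w‖ ≤ c * ‖w‖) (g : H) :
    ‖projError W (K g)‖ ≤ c * ‖projError V g‖ := by
  set w := projError W (K g)
  have hw : w ∈ Wᗮ := projError_mem_orthogonal W _
  have hew : inner ℝ e w = 0 := hw e heW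
  have hKw : K w ∈ Vᗮ := apply_mem_orthogonal hK heW hVW hw
  have h1 := hK g w
  rw [hew, mul_zero] at h1
  have h3 : inner ℝ (projError V g) (K w) = inner ℝ g (K w) := by
    rw [projError_apply, inner_sub_left, hKw _ (Submodule.starProjection_apply_mem V g), sub_zero]
  have h4 : inner ℝ w w = inner ℝ (K g) w := by
    have h : inner ℝ (K g - W.starProjection (K g)) w = inner ℝ (K g) w := by
      rw [inner_sub_left, hw _ (Submodule.starProjection_apply_mem W _), sub_zero]
    exact h
  have h2 : ‖w‖ ^ 2 ≤ c * ‖projError V g‖ * ‖w‖ := by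
    rw [← real_inner_self_eq_norm_sq]
    calc inner ℝ w w = -inner ℝ (projError V g) (K w) := by linarith
      _ ≤ ‖projError V g‖ * ‖K w‖ := by
        rw [← inner_neg_left, ← norm_neg (projError V g)]; exact real_inner_le_norm _ _
      _ ≤ ‖projError V g‖ * (c * ‖w‖) := by gcongr; exact hW _ hw
      _ = c * ‖projError V g‖ * ‖w‖ := by ring
  rcases (norm_nonneg w).eq_or_lt with h | h
  · rw [← h]; positivity
  · nlinarith

/-- For a chain of spaces `V₀, V₁, …` with `K V_p ⊆ V_{p+1}`, the first order constant of `V₀`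
controls the approximation of `(p+1)`-fold integrals in `V_p`. -/
theorem norm_projError_iterate_le {K : H →L[ℝ] H} {e : H}
    (hK : ∀ u v, inner ℝ (K u) v + inner ℝ u (K v) = inner ℝ e u * inner ℝ e v)
    (V : ℕ → Submodule ℝ H) [∀ p, (V p).HasOrthogonalProjection]
    (he : ∀ p, e ∈ V p) (hV : ∀ p, ∀ v ∈ V p, K v ∈ V (p + 1)) {c : ℝ} (hc : 0 ≤ c)
    (h0 : ∀ v ∈ (V 0)ᗮ, ‖K v‖ ≤ c * ‖v‖) (p : ℕ) (g : H) :
    ‖projError (V p) ((K ^ (p + 1)) g)‖ ≤ c ^ (p + 1) * ‖g‖ := by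
  have hp : ∀ p, ∀ v ∈ (V p)ᗮ, ‖K v‖ ≤ c * ‖v‖ := by
    intro p
    induction p with
    | zero => exact h0
    | succ p ih => exact fun w hw => norm_apply_le_of_mem_orthogonal hK (he _) (hV p) hc ih hw
  induction p with
  | zero =>
    have := norm_projError_apply_le (V := ⊥) hK (he 0) (by simp) hc h0 g
    simpa [projError_apply] using this
  | succ p ih =>
    have h := norm_projError_apply_le hK (he (p + 1)) (hV p) hc (hp (p + 1)) ((K ^ (p + 1)) g)
    rw [pow_succ' K, mul_apply_eq_comp]
    calc _ ≤ _ := h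
      _ ≤ c * (c ^ (p + 1) * ‖g‖) := by gcongr
      _ = _ := by ring

end Abstract

/-! ### Integration as an operator on `L²(0,1)` -/

instance : IsProbabilityMeasure unitMeasure := ⟨by simp⟩

theorem inner_eq_integral (u v : L2) :
    inner ℝ u v = ∫ x in Set.Ioo (0 : ℝ) 1, u x * v x := by
  rw [L2.inner_def]
  exact integral_congr_ae (.of_forall fun x => mul_comm _ _)

theorem inner_eq_integral_of_ae {u v : L2} {f g : ℝ → ℝ} (hf : u =ᵐ[unitMeasure] f)
    (hg : v =ᵐ[unitMeasure] g) : inner ℝ u v = ∫ x in Set.Ioo (0 : ℝ) 1, f x * g x := by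
  rw [inner_eq_integral]
  exact integral_congr_ae (hf.mul hg)

theorem norm_sq_eq_integral_of_ae {u : L2} {f : ℝ → ℝ} (hf : u =ᵐ[unitMeasure] f) :
    ‖u‖ ^ 2 = ∫ x in Set.Ioo (0 : ℝ) 1, f x ^ 2 := by
  rw [← real_inner_self_eq_norm_sq, inner_eq_integral_of_ae hf hf]
  simp only [sq]

theorem integrableOn_coe (u : L2) : IntegrableOn u (Set.Ioo 0 1) :=
  (Lp.memLp u).integrable one_le_two

theorem intervalIntegrable_coe (u : L2) {a b : ℝ} (ha : a ∈ Set.Icc (0 : ℝ) 1)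
    (hb : b ∈ Set.Icc (0 : ℝ) 1) : IntervalIntegrable u volume a b := by
  have h : IntegrableOn u (Set.uIcc (0 : ℝ) 1) := by
    rw [Set.uIcc_of_le zero_le_one, integrableOn_Icc_iff_integrableOn_Ioo]
    exact integrableOn_coe u
  refine IntervalIntegrable.mono_set (a := 0) (b := 1)
    ((intervalIntegrable_iff' (by simp)).2 h) ?_
  rw [Set.uIcc_of_le (zero_le_one (α := ℝ))]
  exact Set.uIcc_subset_Icc ha hb

/-- The primitive `x ↦ ∫₀ˣ f`. -/
def primitive (f : ℝ → ℝ) (x : ℝ) : ℝ := ∫ t in (0 : ℝ)..x, f t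

theorem primitive_congr {f g : ℝ → ℝ} (h : f =ᵐ[unitMeasure] g) {x : ℝ}
    (hx : x ∈ Set.Icc (0 : ℝ) 1) : primitive f x = primitive g x := by
  unfold primitive
  rw [intervalIntegral.integral_of_le hx.1, intervalIntegral.integral_of_le hx.1,
    integral_Ioc_eq_integral_Ioo, integral_Ioc_eq_integral_Ioo]
  exact integral_congr_ae (ae_restrict_of_ae_restrict_of_subset (Set.Ioo_subset_Ioo_right hx.2) h)

theorem primitive_congr_ae {f g : ℝ → ℝ} (h : f =ᵐ[unitMeasure] g) :
    primitive f =ᵐ[unitMeasure] primitive g := by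
  filter_upwards [ae_restrict_mem measurableSet_Ioo] with x hx
  exact primitive_congr h (Set.Ioo_subset_Icc_self hx)

theorem primitive_sub_primitive (u : L2) {x y : ℝ} (hx : x ∈ Set.Icc (0 : ℝ) 1)
    (hy : y ∈ Set.Icc (0 : ℝ) 1) : primitive u y - primitive u x = ∫ t in x..y, u t :=
  intervalIntegral.integral_interval_sub_left (intervalIntegrable_coe u (by simp) hy)
    (intervalIntegrable_coe u (by simp) hx)

theorem continuousOn_primitive {f : ℝ → ℝ} (hf : IntegrableOn f (Set.Ioo 0 1)) :
    ContinuousOn (primitive f) (Set.Icc 0 1) := by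
  have h : IntegrableOn f (Set.uIcc (0 : ℝ) 1) := by
    rwa [Set.uIcc_of_le zero_le_one, integrableOn_Icc_iff_integrableOn_Ioo]
  have := intervalIntegral.continuousOn_primitive_interval h
  rwa [Set.uIcc_of_le zero_le_one] at this

theorem norm_primitive_le (u : L2) {x : ℝ} (hx : x ∈ Set.Icc (0 : ℝ) 1) :
    ‖primitive u x‖ ≤ ‖u‖ := by
  have h1 : ‖primitive u x‖ ≤ ∫ t in Set.Ioo (0 : ℝ) 1, ‖u t‖ := by
    unfold primitive
    rw [intervalIntegral.integral_of_le hx.1, integral_Ioc_eq_integral_Ioo]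
    refine (norm_integral_le_integral_norm _).trans ?_
    exact setIntegral_mono_set (integrableOn_coe u).norm (.of_forall fun _ => norm_nonneg _)
      (Set.Ioo_subset_Ioo_right hx.2).eventuallyLE
  refine h1.trans ?_
  rw [Lp.norm_def, integral_norm_eq_lintegral_enorm (Lp.aestronglyMeasurable u),
    ← eLpNorm_one_eq_lintegral_enorm]
  exact ENNReal.toReal_mono (Lp.eLpNorm_ne_top u)
    (eLpNorm_le_eLpNorm_of_exponent_le one_le_two (Lp.aestronglyMeasurable u))

theorem memLp_of_continuousOn {f : ℝ → ℝ} (hf : ContinuousOn f (Set.Icc 0 1)) :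
    MemLp f 2 unitMeasure := by
  obtain ⟨C, hC⟩ := isCompact_Icc.exists_bound_of_continuousOn hf
  refine MemLp.of_bound
    ((hf.mono Set.Ioo_subset_Icc_self).aestronglyMeasurable measurableSet_Ioo) C ?_
  filter_upwards [ae_restrict_mem measurableSet_Ioo] with x hx
  exact hC x (Set.Ioo_subset_Icc_self hx)

theorem memLp_primitive (u : L2) : MemLp (primitive u) 2 unitMeasure :=
  memLp_of_continuousOn (continuousOn_primitive (integrableOn_coe u))

/-- The operator `u ↦ ∫₀ˣ u` on `L²(0,1)`. -/
def integralOp : L2 →L[ℝ] L2 :=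
  LinearMap.mkContinuous
    { toFun := fun u => (memLp_primitive u).toLp _
      map_add' := fun u v => by
        refine Lp.ext ?_
        filter_upwards [(memLp_primitive (u + v)).coeFn_toLp, (memLp_primitive u).coeFn_toLp,
          (memLp_primitive v).coeFn_toLp, ae_restrict_mem measurableSet_Ioo,
          Lp.coeFn_add ((memLp_primitive u).toLp _) ((memLp_primitive v).toLp _)]
          with x h1 h2 h3 hx h4
        have hx' := Set.Ioo_subset_Icc_self hx
        rw [h1, h4, Pi.add_apply, h2, h3, primitive_congr (Lp.coeFn_add u v) hx']
        exact intervalIntegral.integral_add (intervalIntegrable_coe u (by simp) hx')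
          (intervalIntegrable_coe v (by simp) hx')
      map_smul' := fun c u => by
        refine Lp.ext ?_
        filter_upwards [(memLp_primitive (c • u)).coeFn_toLp, (memLp_primitive u).coeFn_toLp,
          ae_restrict_mem measurableSet_Ioo,
          Lp.coeFn_smul c ((memLp_primitive u).toLp _)] with x h1 h2 hx h4
        have hx' := Set.Ioo_subset_Icc_self hx
        rw [h1, RingHom.id_apply, h4, Pi.smul_apply, h2, primitive_congr (Lp.coeFn_smul c u) hx']
        exact intervalIntegral.integral_smul c _ } 1 fun u => by
    rw [one_mul]
    change ‖(memLp_primitive u).toLp _‖ ≤ ‖u‖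
    refine (Lp.norm_le_of_ae_bound (norm_nonneg u) (f := (memLp_primitive u).toLp _) ?_).trans ?_
    · filter_upwards [(memLp_primitive u).coeFn_toLp, ae_restrict_mem measurableSet_Ioo]
        with x h1 hx
      rw [h1]
      exact norm_primitive_le u (Set.Ioo_subset_Icc_self hx)
    · simp [measureUnivNNReal]

theorem integralOp_coe (u : L2) : integralOp u =ᵐ[unitMeasure] primitive u :=
  (memLp_primitive u).coeFn_toLp

theorem integralOp_coe_of_ae {u : L2} {f : ℝ → ℝ} (h : u =ᵐ[unitMeasure] f) :
    integralOp u =ᵐ[unitMeasure] primitive f :=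
  (integralOp_coe u).trans (primitive_congr_ae h)

/-- The constant function `1` in `L²(0,1)`. -/
def oneL2 : L2 := (memLp_const (1 : ℝ)).toLp _

theorem oneL2_coe : oneL2 =ᵐ[unitMeasure] fun _ => (1 : ℝ) := MemLp.coeFn_toLp _

/-- Every element of `L²(0,1)` is a limit of continuous functions, so closed conditions may be
checked on these. -/
theorem induction_continuous {P : L2 → Prop} (hP : IsClosed {u | P u})
    (h : ∀ (u : L2) (f : ℝ → ℝ), Continuous f → u =ᵐ[unitMeasure] f → P u) (u : L2) : P u :=
  (BoundedContinuousFunction.toLp_denseRange (p := 2) ℝ unitMeasure ℝ (by simp)).induction_on u hP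
    fun f => h _ f f.continuous (BoundedContinuousFunction.coeFn_toLp _ _ _ f)

/-- Integration by parts: the sum of the integration operator and its adjoint has rank one. -/
theorem inner_integralOp_add (u v : L2) :
    inner ℝ (integralOp u) v + inner ℝ u (integralOp v) = inner ℝ oneL2 u * inner ℝ oneL2 v := by
  induction u using induction_continuous with
  | hP => exact isClosed_eq (by fun_prop) (by fun_prop)
  | h u f hf huf =>
  induction v using induction_continuous with
  | hP => exact isClosed_eq (by fun_prop) (by fun_prop)
  | h v g hg hvg =>
  have hF : ∀ x, HasDerivAt (primitive f) (f x) x := fun x =>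
    (hf.integral_hasStrictDerivAt 0 x).hasDerivAt
  have hG : ∀ x, HasDerivAt (primitive g) (g x) x := fun x =>
    (hg.integral_hasStrictDerivAt 0 x).hasDerivAt
  have hFc : Continuous (primitive f) := continuous_iff_continuousAt.2 fun x => (hF x).continuousAt
  have hGc : Continuous (primitive g) := continuous_iff_continuousAt.2 fun x => (hG x).continuousAt
  rw [inner_eq_integral_of_ae (integralOp_coe_of_ae huf) hvg,
    inner_eq_integral_of_ae huf (integralOp_coe_of_ae hvg),
    inner_eq_integral_of_ae oneL2_coe huf, inner_eq_integral_of_ae oneL2_coe hvg]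
  simp only [← integral_Ioc_eq_integral_Ioo, ← intervalIntegral.integral_of_le zero_le_one,
    one_mul]
  have h := intervalIntegral.integral_deriv_mul_eq_sub (a := 0) (b := 1) (u := primitive f)
    (v := primitive g) (fun x _ => hF x) (fun x _ => hG x) (hf.intervalIntegrable _ _)
    (hg.intervalIntegrable _ _)
  have h1 := intervalIntegral.integral_add (μ := volume) (a := 0) (b := 1)
    ((hf.mul hGc).intervalIntegrable _ _) ((hFc.mul hg).intervalIntegrable _ _)
  simp only [Pi.mul_apply] at h1
  rw [h1] at h
  have h0 : ∀ f, primitive f 0 = 0 := fun f => intervalIntegral.integral_same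
  rw [h0, h0, mul_zero, sub_zero] at h
  rw [add_comm]
  exact h

/-! ### Poincaré's inequality with the sharp constant -/

/-- A double zero of `w ^ 2` outweighs a simple zero of `s`; the value `c / 0 = 0` at the zero is
the right one. -/
theorem continuousAt_sq_mul_div {w s c : ℝ → ℝ} {x₀ w' s' : ℝ} (hw : HasDerivAt w w' x₀)
    (hs : HasDerivAt s s' x₀) (hc : ContinuousAt c x₀) (hw0 : w x₀ = 0) (hs0 : s x₀ = 0)
    (hs' : s' ≠ 0) : ContinuousAt (fun x => w x ^ 2 * (c x / s x)) x₀ := by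
  have h1 : w =O[nhds x₀] s := by
    have h := (HasDerivAtFilter.isTheta_sub hs hs').isBigO_symm
    have h := hw.isBigO_sub.trans (h.comp_tendsto
      (Filter.tendsto_id.prodMk (Filter.tendsto_const_pure (b := x₀))))
    simpa [Function.comp_def, hw0, hs0] using h
  have h2 : (fun x => w x * (s x)⁻¹) =O[nhds x₀] fun _ => (1 : ℝ) := by
    refine (h1.mul (Asymptotics.isBigO_refl _ _)).trans (Asymptotics.IsBigO.of_bound 1 ?_)
    filter_upwards with x
    rcases eq_or_ne (s x) 0 with h | h <;> simp [h]
  have h3 : (fun x => w x ^ 2 * (c x / s x)) =O[nhds x₀] fun x => w x * (c x * 1) := by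
    have : (fun x => w x ^ 2 * (c x / s x)) = fun x => w x * (c x * (w x * (s x)⁻¹)) := by
      ext x; ring
    rw [this]
    exact (Asymptotics.isBigO_refl _ _).mul ((Asymptotics.isBigO_refl _ _).mul h2)
  have h4 : Filter.Tendsto (fun x => w x * (c x * 1)) (nhds x₀) (nhds 0) := by
    have := hw.continuousAt.tendsto.mul (hc.tendsto.mul_const 1)
    rwa [hw0, zero_mul] at this
  have h5 := h3.trans_tendsto h4
  unfold ContinuousAt
  simpa [hw0] using h5

/-- Poincaré's inequality for a function vanishing at both ends of the interval: with
`c = κ cot (κ (x - a))`, `κ = π / (b - a)`, one has `w'² - κ² w² = (w' - c w)² + (c w²)'`, and the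
boundary values of `c w²` are zero. -/
theorem integral_sq_le_of_vanishing {a b : ℝ} (hab : a < b) {w g : ℝ → ℝ} (hg : Continuous g)
    (hw : ∀ x, HasDerivAt w (g x) x) (ha : w a = 0) (hb : w b = 0) :
    ∫ x in a..b, w x ^ 2 ≤ ((b - a) / Real.pi) ^ 2 * ∫ x in a..b, g x ^ 2 := by
  have hpi := Real.pi_pos
  have hba : 0 < b - a := sub_pos.2 hab
  set κ := Real.pi / (b - a) with hκ
  have hκ0 : 0 < κ := by positivity
  have hκb : κ * (b - a) = Real.pi := by rw [hκ]; field_simp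
  have hwc : Continuous w := continuous_iff_continuousAt.2 fun x => (hw x).continuousAt
  have hsin : ∀ x, HasDerivAt (fun x => Real.sin (κ * (x - a))) (Real.cos (κ * (x - a)) * κ) x :=
    fun x => by
      have h := (((hasDerivAt_id x).sub_const a).const_mul κ).sin
      simpa using h
  have hcos : ∀ x, HasDerivAt (fun x => κ * Real.cos (κ * (x - a)))
      (κ * (-Real.sin (κ * (x - a)) * κ)) x := fun x => by
    have h := ((((hasDerivAt_id x).sub_const a).const_mul κ).cos).const_mul κ
    simpa using h
  set F : ℝ → ℝ := fun x => w x ^ 2 * (κ * Real.cos (κ * (x - a)) / Real.sin (κ * (x - a)))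
  have hpos : ∀ x ∈ Set.Ioo a b, 0 < Real.sin (κ * (x - a)) := fun x hx => by
    refine Real.sin_pos_of_pos_of_lt_pi (mul_pos hκ0 (sub_pos.2 hx.1)) ?_
    rw [← hκb]
    exact mul_lt_mul_of_pos_left (by linarith [hx.2]) hκ0
  have hFd : ∀ x ∈ Set.Ioo a b, HasDerivAt F
      (2 * w x * g x * (κ * Real.cos (κ * (x - a)) / Real.sin (κ * (x - a)))
        + w x ^ 2 * ((κ * (-Real.sin (κ * (x - a)) * κ) * Real.sin (κ * (x - a))
          - κ * Real.cos (κ * (x - a)) * (Real.cos (κ * (x - a)) * κ))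
            / Real.sin (κ * (x - a)) ^ 2)) x := fun x hx => by
    have h := ((hw x).pow 2).mul ((hcos x).div (hsin x) (hpos x hx).ne')
    refine HasDerivAt.congr_deriv (f := F) h ?_
    simp
  have hFc : ContinuousOn F (Set.Icc a b) := by
    intro x hx
    refine ContinuousAt.continuousWithinAt ?_
    rcases hx.1.eq_or_lt with rfl | h1
    · exact continuousAt_sq_mul_div (hw a) (hsin a) (by fun_prop) ha (by simp)
        (by simp [hκ0.ne'])
    rcases hx.2.eq_or_lt with rfl | h2
    · exact continuousAt_sq_mul_div (hw x) (hsin x) (by fun_prop) hb (by simp [hκb])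
        (by simp [hκ0.ne', hκb])
    · exact (hFd x ⟨h1, h2⟩).continuousAt
  have key := intervalIntegral.sub_le_integral_of_hasDeriv_right_of_le hab.le hFc
    (fun x hx => (hFd x hx).hasDerivWithinAt) (φ := fun x => g x ^ 2 - κ ^ 2 * w x ^ 2)
    (Continuous.integrableOn_Icc (by fun_prop)) (fun x hx => by
      have hs := hpos x hx
      have h1 := Real.sin_sq_add_cos_sq (κ * (x - a))
      set S := Real.sin (κ * (x - a))
      set C := Real.cos (κ * (x - a))
      have h2 : (κ * (-S * κ) * S - κ * C * (C * κ)) / S ^ 2 = -κ ^ 2 - (κ * C / S) ^ 2 := by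
        field_simp
      rw [h2]
      nlinarith [sq_nonneg (g x - κ * C / S * w x)])
  have hFa : F a = 0 := by simp [F]
  have hFb : F b = 0 := by simp [F, hκb]
  rw [hFa, hFb, sub_zero, intervalIntegral.integral_sub
    ((by fun_prop : Continuous fun x => g x ^ 2).intervalIntegrable _ _)
    ((by fun_prop : Continuous fun x => κ ^ 2 * w x ^ 2).intervalIntegrable _ _),
    intervalIntegral.integral_const_mul] at key
  have h3 : ((b - a) / Real.pi) ^ 2 * κ ^ 2 = 1 := by rw [hκ]; field_simp
  have h4 := mul_le_mul_of_nonneg_left (sub_nonneg.1 key) (sq_nonneg ((b - a) / Real.pi))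
  rwa [← mul_assoc, h3, one_mul] at h4

/-! ### Integration of maximally smooth splines -/

theorem exists_derivative_eq {p : ℕ} {P : ℝ[X]} (hP : P.natDegree ≤ p) :
    ∃ Q : ℝ[X], Q.natDegree ≤ p + 1 ∧ derivative Q = P := by
  refine ⟨∑ i ∈ Finset.range (p + 1), C (P.coeff i / (i + 1)) * X ^ (i + 1), ?_, ?_⟩
  · refine natDegree_sum_le_of_forall_le _ _ fun i hi => ?_
    refine (natDegree_C_mul_X_pow_le _ _).trans ?_
    have := Finset.mem_range.1 hi
    omega
  · conv_rhs => rw [P.as_sum_range_C_mul_X_pow' (Nat.lt_succ_of_le hP)]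
    rw [derivative_sum]
    refine Finset.sum_congr rfl fun i _ => ?_
    rw [derivative_C_mul_X_pow]
    congr 2
    push_cast
    field_simp

theorem hasDerivWithinAt_primitive {f : ℝ → ℝ} (hf : ContinuousOn f (Set.Icc 0 1)) {x : ℝ}
    (hx : x ∈ Set.Icc (0 : ℝ) 1) :
    HasDerivWithinAt (primitive f) (f x) (Set.Icc 0 1) x := by
  have : Fact (x ∈ Set.Icc (0 : ℝ) 1) := ⟨hx⟩
  refine intervalIntegral.integral_hasDerivWithinAt_right (s := Set.Icc 0 1) (t := Set.Icc 0 1)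
    ?_ ?_ (hf x hx)
  · exact (hf.mono (by rw [Set.uIcc_of_le hx.1]; exact
      Set.Icc_subset_Icc_right hx.2)).intervalIntegrable
  · exact hf.stronglyMeasurableAtFilter_nhdsWithin measurableSet_Icc x

theorem contDiffOn_primitive {f : ℝ → ℝ} {r : ℕ} (hf : ContDiffOn ℝ r f (Set.Icc 0 1)) :
    ContDiffOn ℝ (r + 1 : ℕ) (primitive f) (Set.Icc 0 1) := by
  have hd := fun x hx => hasDerivWithinAt_primitive hf.continuousOn (x := x) hx
  push_cast
  rw [contDiffOn_succ_iff_derivWithin (uniqueDiffOn_Icc zero_lt_one)]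
  refine ⟨fun x hx => (hd x hx).differentiableWithinAt, by simp, ?_⟩
  exact hf.congr fun x hx => (hd x hx).derivWithin (uniqueDiffOn_Icc zero_lt_one x hx)

theorem segment_subset (n : ℕ+) (j : Fin n) : segment n j ⊆ Set.Icc 0 1 := by
  intro x hx
  have hn : (0 : ℝ) < (n : ℝ) := by exact_mod_cast n.pos
  refine ⟨le_trans (by positivity) hx.1, hx.2.le.trans ?_⟩
  rw [div_le_one hn]
  have := j.2
  exact_mod_cast this

theorem primitive_mem_splineFun {p : ℕ} {m : ℕ+} {f : ℝ → ℝ} {u : L2}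
    (hf : f ∈ splineFun p ((p : ℤ) - 1) m) (hu : u =ᵐ[unitMeasure] f) :
    primitive f ∈ splineFun (p + 1) (((p + 1 : ℕ) : ℤ) - 1) m := by
  have hfi : IntegrableOn f (Set.Ioo 0 1) := (integrableOn_coe u).congr hu
  refine ⟨fun _ => ?_, fun j => ?_⟩
  · have h : (((p + 1 : ℕ) : ℤ) - 1).toNat = p := by omega
    rw [h]
    cases p with
    | zero => simpa using continuousOn_primitive hfi
    | succ q =>
      refine contDiffOn_primitive ?_
      have := hf.1 (by omega)
      rwa [show (((q + 1 : ℕ) : ℤ) - 1).toNat = q by omega] at this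
  · obtain ⟨P, hP, hPf⟩ := hf.2 j
    obtain ⟨Q, hQ, hQP⟩ := exists_derivative_eq hP
    set a := (j : ℝ) / (m : ℝ) with ha
    refine ⟨C (primitive f a - Q.eval a) + Q,
      (natDegree_add_le _ _).trans (max_le (by simp) hQ), fun x hx => ?_⟩
    have hx1 := segment_subset m j hx
    have ha1 : a ∈ Set.Icc (0 : ℝ) 1 := segment_subset m j ⟨le_rfl, by
      have hn : (0 : ℝ) < (m : ℝ) := by exact_mod_cast m.pos
      exact (div_lt_div_iff_of_pos_right hn).2 (by linarith)⟩
    have h1 : primitive f x - primitive f a = ∫ t in a..x, u t := by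
      rw [← primitive_congr hu hx1, ← primitive_congr hu ha1, primitive_sub_primitive u ha1 hx1]
    have h2 : ∫ t in a..x, u t = ∫ t in a..x, P.eval t := by
      rw [intervalIntegral.integral_of_le hx.1, intervalIntegral.integral_of_le hx.1,
        integral_Ioc_eq_integral_Ioo, integral_Ioc_eq_integral_Ioo]
      refine integral_congr_ae ?_
      have h3 := ae_restrict_of_ae_restrict_of_subset (Set.Ioo_subset_Ioo ha1.1 hx1.2) hu
      filter_upwards [h3, ae_restrict_mem measurableSet_Ioo] with t ht htm
      rw [ht, hPf t ⟨htm.1.le, htm.2.trans hx.2⟩]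
    have h3 : ∫ t in a..x, P.eval t = Q.eval x - Q.eval a :=
      intervalIntegral.integral_eq_sub_of_hasDerivAt
        (fun t _ => by simpa [hQP] using Q.hasDerivAt t) (P.continuous.intervalIntegrable _ _)
    simp only [eval_add, eval_C]
    linarith

/-- The maximally smooth splines of degree `p` in `L²(0,1)`. -/
abbrev smoothSplines (m : ℕ+) (p : ℕ) : Submodule ℝ L2 :=
  classes (splineFun p ((p : ℤ) - 1) m)

theorem integralOp_mem_smoothSplines {m : ℕ+} {p : ℕ} {v : L2} (hv : v ∈ smoothSplines m p) :
    integralOp v ∈ smoothSplines m (p + 1) := by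
  obtain ⟨f, hf, hvf⟩ := hv
  exact ⟨primitive f, primitive_mem_splineFun hf hvf, integralOp_coe_of_ae hvf⟩

theorem poly_mem_splineFun {p : ℕ} {k : ℤ} {m : ℕ+} {P : ℝ[X]} (hP : P.natDegree ≤ p) :
    (fun x => P.eval x) ∈ splineFun p k m :=
  ⟨fun _ => (by simpa using P.contDiff_aeval (𝕜 := ℝ) _ : ContDiff ℝ _ fun x => P.eval x).contDiffOn,
    fun _ => ⟨P, hP, fun _ _ => rfl⟩⟩

theorem oneL2_mem_smoothSplines (m : ℕ+) (p : ℕ) : oneL2 ∈ smoothSplines m p :=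
  ⟨_, poly_mem_splineFun (P := 1) (by simp), by simpa using oneL2_coe⟩

/-! ### The error of maximally smooth splines -/

theorem indicator_mem_splineFun (m : ℕ+) (j : ℕ) :
    (Set.Iio ((j : ℝ) / (m : ℝ))).indicator (fun _ => (1 : ℝ)) ∈
      splineFun 0 (((0 : ℕ) : ℤ) - 1) m := by
  have hm : (0 : ℝ) < (m : ℝ) := by exact_mod_cast m.pos
  refine ⟨fun h => by omega, fun i => ?_⟩
  by_cases hij : (i : ℕ) < j
  · refine ⟨1, by simp, fun x hx => ?_⟩
    rw [Set.indicator_of_mem]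
    · simp
    · refine hx.2.trans_le ((div_le_div_iff_of_pos_right hm).2 ?_)
      exact_mod_cast hij
  · refine ⟨0, by simp, fun x hx => ?_⟩
    rw [Set.indicator_of_notMem]
    · simp
    · refine fun h => (lt_irrefl x) (h.trans_le (le_trans ?_ hx.1))
      refine (div_le_div_iff_of_pos_right hm).2 ?_
      exact_mod_cast not_lt.1 hij

theorem node_mem_Icc (m : ℕ+) {j : ℕ} (hj : j ≤ m) : (j : ℝ) / (m : ℝ) ∈ Set.Icc (0 : ℝ) 1 := by
  have hm : (0 : ℝ) < (m : ℝ) := by exact_mod_cast m.pos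
  refine ⟨by positivity, ?_⟩
  rw [div_le_one hm]
  exact_mod_cast hj

/-- The primitive of a function orthogonal to the step functions vanishes at the nodes. -/
theorem primitive_node_eq_zero {m : ℕ+} {v : L2} (hv : v ∈ (smoothSplines m 0)ᗮ) {j : ℕ}
    (hj : j ≤ m) : primitive v ((j : ℝ) / (m : ℝ)) = 0 := by
  set a := (j : ℝ) / (m : ℝ)
  have ha : a ∈ Set.Icc (0 : ℝ) 1 := node_mem_Icc m hj
  have hmem : MemLp ((Set.Iio a).indicator fun _ => (1 : ℝ)) 2 unitMeasure :=
    (memLp_const 1).indicator measurableSet_Iio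
  have h := hv (hmem.toLp _) ⟨_, indicator_mem_splineFun m j, hmem.coeFn_toLp⟩
  rw [inner_eq_integral_of_ae hmem.coeFn_toLp (Filter.EventuallyEq.refl _ _)] at h
  rw [primitive, intervalIntegral.integral_of_le ha.1, integral_Ioc_eq_integral_Ioo]
  refine Eq.trans ?_ h
  have h1 : ∀ x, (Set.Iio a).indicator (fun _ => (1 : ℝ)) x * v x = (Set.Iio a).indicator v x :=
    fun x => by by_cases hx : x ∈ Set.Iio a <;> simp [hx]
  simp_rw [h1]
  rw [setIntegral_indicator measurableSet_Iio, Set.Ioo_inter_Iio, min_eq_right ha.2]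

theorem intervalIntegrable_coe_sq (u : L2) {a b : ℝ} (ha : a ∈ Set.Icc (0 : ℝ) 1)
    (hb : b ∈ Set.Icc (0 : ℝ) 1) : IntervalIntegrable (fun x => u x ^ 2) volume a b := by
  have h : IntegrableOn (fun x => u x ^ 2) (Set.uIcc (0 : ℝ) 1) := by
    rw [Set.uIcc_of_le zero_le_one, integrableOn_Icc_iff_integrableOn_Ioo]
    exact (Lp.memLp u).integrable_sq
  refine IntervalIntegrable.mono_set (a := 0) (b := 1)
    ((intervalIntegrable_iff' (by simp)).2 h) ?_
  rw [Set.uIcc_of_le (zero_le_one (α := ℝ))]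
  exact Set.uIcc_subset_Icc ha hb

theorem integral_congr_of_ae_Ioo {f g : ℝ → ℝ} {a b : ℝ} (hab : a ≤ b)
    (h : f =ᵐ[volume.restrict (Set.Ioo a b)] g) : ∫ x in a..b, f x = ∫ x in a..b, g x := by
  rw [intervalIntegral.integral_of_le hab, intervalIntegral.integral_of_le hab,
    integral_Ioc_eq_integral_Ioo, integral_Ioc_eq_integral_Ioo]
  exact integral_congr_ae h

/-- The inequality of Poincaré on a segment `[a, b]` in terms of a class `v` that has a continuous
representative there. -/
theorem integral_primitive_sq_le {v : L2} {a b : ℝ} (hab : a < b) (ha : a ∈ Set.Icc (0 : ℝ) 1)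
    (hb : b ∈ Set.Icc (0 : ℝ) 1) (hva : primitive v a = 0) (hvb : primitive v b = 0) {g : ℝ → ℝ}
    (hg : Continuous g) (hvg : v =ᵐ[volume.restrict (Set.Ioo a b)] g) :
    ∫ x in a..b, primitive v x ^ 2 ≤ ((b - a) / Real.pi) ^ 2 * ∫ x in a..b, v x ^ 2 := by
  have hw : ∀ x ∈ Set.Icc a b, primitive v x = ∫ t in a..x, g t := fun x hx => by
    have hx1 : x ∈ Set.Icc (0 : ℝ) 1 := ⟨ha.1.trans hx.1, hx.2.trans hb.2⟩
    rw [← sub_zero (primitive v x), ← hva, primitive_sub_primitive v ha hx1]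
    exact integral_congr_of_ae_Ioo hx.1
      (ae_restrict_of_ae_restrict_of_subset (Set.Ioo_subset_Ioo_right hx.2) hvg)
  have h := integral_sq_le_of_vanishing hab hg
    (fun x => (hg.integral_hasStrictDerivAt a x).hasDerivAt) intervalIntegral.integral_same
    (by rw [← hw b ⟨hab.le, le_rfl⟩, hvb])
  rw [integral_congr_of_ae_Ioo hab.le (f := fun x => v x ^ 2) (g := fun x => g x ^ 2)
    (by filter_upwards [hvg] with x hx; rw [hx])]
  refine le_trans (le_of_eq ?_) h
  refine intervalIntegral.integral_congr fun x hx => ?_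
  rw [Set.uIcc_of_le hab.le] at hx
  simp only [hw x hx]

theorem norm_sq_eq_intervalIntegral {u : L2} {f : ℝ → ℝ} (hf : u =ᵐ[unitMeasure] f) :
    ‖u‖ ^ 2 = ∫ x in (0 : ℝ)..1, f x ^ 2 := by
  rw [norm_sq_eq_integral_of_ae hf, intervalIntegral.integral_of_le zero_le_one,
    integral_Ioc_eq_integral_Ioo]

/-- Poincaré's inequality on each segment: orthogonality to the step functions makes `∫₀ˣ v` vanish
at all nodes. By density it is enough to treat `v = f - P₀ f` with `f` continuous. -/
theorem norm_integralOp_le_of_orthogonal (m : ℕ+) {v : L2} (hv : v ∈ (smoothSplines m 0)ᗮ) :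
    ‖integralOp v‖ ≤ 1 / (m * Real.pi) * ‖v‖ := by
  have hm : (0 : ℝ) < (m : ℝ) := by exact_mod_cast m.pos
  have hpi := Real.pi_pos
  suffices h : ∀ u : L2, ‖integralOp (projError (smoothSplines m 0) u)‖ ≤
      1 / (m * Real.pi) * ‖projError (smoothSplines m 0) u‖ by
    have h1 : projError (smoothSplines m 0) v = v := by
      rw [projError_apply, (Submodule.starProjection_apply_eq_zero_iff _).2 hv, sub_zero]
    simpa only [h1] using h v
  refine induction_continuous (isClosed_le (by fun_prop) (by fun_prop)) fun u f hf huf => ?_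
  set v := projError (smoothSplines m 0) u with hvdef
  have hv : v ∈ (smoothSplines m 0)ᗮ := projError_mem_orthogonal _ _
  obtain ⟨s, hs, hus⟩ : (smoothSplines m 0).starProjection u ∈ smoothSplines m 0 :=
    Submodule.starProjection_apply_mem _ _
  have hvs : v =ᵐ[unitMeasure] fun x => f x - s x := by
    filter_upwards [Lp.coeFn_sub u ((smoothSplines m 0).starProjection u), huf, hus]
      with x h1 h2 h3
    rw [← h2, ← h3]
    exact h1
  set a : ℕ → ℝ := fun j => (j : ℝ) / (m : ℝ) with hadef
  have ha : ∀ {j : ℕ}, j ≤ m → a j ∈ Set.Icc (0 : ℝ) 1 := fun hj => node_mem_Icc m hj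
  have ha0 : a 0 = 0 := by simp [a]
  have ham : a m = 1 := by simp [a, hm.ne']
  have hlt : ∀ j, a j < a (j + 1) := fun j => by
    refine (div_lt_div_iff_of_pos_right hm).2 ?_
    push_cast
    linarith
  have hdiff : ∀ j, a (j + 1) - a j = 1 / m := fun j => by
    simp only [a]; push_cast; ring
  have hseg : ∀ j < (m : ℕ), ∫ x in a j..a (j + 1), primitive v x ^ 2 ≤
      (1 / (m * Real.pi)) ^ 2 * ∫ x in a j..a (j + 1), v x ^ 2 := fun j hj => by
    obtain ⟨P, hP, hPs⟩ := hs.2 ⟨j, hj⟩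
    have hvg : v =ᵐ[volume.restrict (Set.Ioo (a j) (a (j + 1)))] fun x => f x - P.eval x := by
      have h := ae_restrict_of_ae_restrict_of_subset
        (Set.Ioo_subset_Ioo (ha hj.le).1 (ha (j := j + 1) hj).2) hvs
      filter_upwards [h, ae_restrict_mem measurableSet_Ioo] with x hx hxm
      rw [hx, hPs x ⟨hxm.1.le, ?_⟩]
      simpa [a] using hxm.2
    have h := integral_primitive_sq_le (hlt j) (ha hj.le) (ha (j := j + 1) hj)
      (primitive_node_eq_zero hv hj.le) (primitive_node_eq_zero hv (j := j + 1) hj)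
      (hf.sub P.continuous) hvg
    rwa [hdiff, div_div] at h
  have hends : ∀ F : ℝ → ℝ, ∫ x in (0 : ℝ)..1, F x = ∫ x in a 0..a m, F x := fun F => by
    rw [ha0, ham]
  have hsum : ‖integralOp v‖ ^ 2 ≤ (1 / (m * Real.pi) * ‖v‖) ^ 2 := by
    rw [mul_pow, norm_sq_eq_intervalIntegral (integralOp_coe v),
      norm_sq_eq_intervalIntegral (Filter.EventuallyEq.refl _ v), hends, hends,
      ← intervalIntegral.sum_integral_adjacent_intervals (fun j hj => ?_),
      ← intervalIntegral.sum_integral_adjacent_intervals (fun j hj => ?_), Finset.mul_sum]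
    · exact Finset.sum_le_sum fun j hj => hseg j (Finset.mem_range.1 hj)
    · exact intervalIntegrable_coe_sq v (ha hj.le) (ha (j := j + 1) hj)
    · refine ContinuousOn.intervalIntegrable ?_
      refine ((continuousOn_primitive (integrableOn_coe v)).pow 2).mono ?_
      exact Set.uIcc_subset_Icc (ha hj.le) (ha (j := j + 1) hj)
  exact le_of_sq_le_sq hsum (by positivity)

/-- Maximally smooth splines of degree `p` on `m` uniform segments approximate `(p+1)`-fold
integrals of `g` with error at most `(1 / (m π))^(p+1) ‖g‖`. -/
theorem norm_projError_smoothSplines_le (m : ℕ+) (p : ℕ) (g : L2) :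
    ‖projError (smoothSplines m p) ((integralOp ^ (p + 1)) g)‖ ≤
      (1 / (m * Real.pi)) ^ (p + 1) * ‖g‖ :=
  norm_projError_iterate_le inner_integralOp_add (smoothSplines m) (oneL2_mem_smoothSplines m)
    (fun _ _ => integralOp_mem_smoothSplines)
    (by have := Real.pi_pos; positivity) (fun _ => norm_integralOp_le_of_orthogonal m) p g

/-! ### Weak derivatives and iterated primitives -/

theorem exists_Icc_of_isCompact_subset_Ioo {K : Set ℝ} (hK : IsCompact K) {a b : ℝ} (hab : a < b)
    (h : K ⊆ Set.Ioo a b) : ∃ a' b', a < a' ∧ b' < b ∧ K ⊆ Set.Icc a' b' := by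
  rcases K.eq_empty_or_nonempty with rfl | hne
  · exact ⟨b, a, hab, hab, by simp⟩
  · exact ⟨sInf K, sSup K, (h (hK.sInf_mem hne)).1, (h (hK.sSup_mem hne)).2,
      fun x hx => ⟨csInf_le hK.bddBelow hx, le_csSup hK.bddAbove hx⟩⟩

/-- A smooth function with compact support in `(a, b)`. -/
structure IsTest (a b : ℝ) (φ : ℝ → ℝ) : Prop where
  contDiff : ContDiff ℝ ∞ φ
  hasCompactSupport : HasCompactSupport φ
  tsupport_subset : tsupport φ ⊆ Set.Ioo a b

namespace IsTest

variable {a b : ℝ} {φ ψ : ℝ → ℝ}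

theorem eq_zero (h : IsTest a b φ) {x : ℝ} (hx : x ∉ Set.Ioo a b) : φ x = 0 :=
  image_eq_zero_of_notMem_tsupport fun hx' => hx (h.tsupport_subset hx')

theorem continuous (h : IsTest a b φ) : Continuous φ := h.contDiff.continuous

theorem deriv (h : IsTest a b φ) : IsTest a b (deriv φ) :=
  ⟨(contDiff_infty_iff_deriv.1 h.contDiff).2, h.hasCompactSupport.deriv,
    (closure_mono support_deriv_subset).trans
      (by rw [IsClosed.closure_eq (isClosed_tsupport φ)]; exact h.tsupport_subset)⟩

theorem iteratedDeriv (h : IsTest a b φ) (r : ℕ) : IsTest a b (iteratedDeriv r φ) := by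
  induction r with
  | zero => simpa using h
  | succ r ih => rw [iteratedDeriv_succ]; exact ih.deriv

theorem const_smul (h : IsTest a b φ) (c : ℝ) : IsTest a b (c • φ) := by
  have hs : tsupport (c • φ) ⊆ tsupport φ := closure_mono (Function.support_const_smul_subset c φ)
  exact ⟨h.contDiff.const_smul c, h.hasCompactSupport.mono' (subset_closure.trans hs),
    hs.trans h.tsupport_subset⟩

theorem sub (h : IsTest a b φ) (h' : IsTest a b ψ) : IsTest a b (φ - ψ) := by
  have hs : tsupport (φ - ψ) ⊆ tsupport φ ∪ tsupport ψ := tsupport_sub φ ψ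
  exact ⟨h.contDiff.sub h'.contDiff, h.hasCompactSupport.sub h'.hasCompactSupport,
    hs.trans (Set.union_subset h.tsupport_subset h'.tsupport_subset)⟩

end IsTest

theorem exists_isTest_integral_eq_one {a b : ℝ} (hab : a < b) :
    ∃ θ, IsTest a b θ ∧ ∫ x, θ x = 1 := by
  let f : ContDiffBump ((a + b) / 2) := ⟨(b - a) / 8, (b - a) / 4, by linarith, by linarith⟩
  refine ⟨f.normed volume, ⟨f.contDiff_normed, f.hasCompactSupport_normed, ?_⟩,
    f.integral_normed⟩
  rw [f.tsupport_normed_eq, Real.closedBall_eq_Icc]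
  exact fun x hx => ⟨by linarith [hx.1, show f.rOut = (b - a) / 4 from rfl],
    by linarith [hx.2, show f.rOut = (b - a) / 4 from rfl]⟩

/-- A continuous function as an element of `L²(0,1)`. -/
def contL2 (ψ : ℝ → ℝ) (hψ : Continuous ψ) : L2 := (memLp_of_continuousOn hψ.continuousOn).toLp ψ

theorem contL2_coe {ψ : ℝ → ℝ} (hψ : Continuous ψ) : contL2 ψ hψ =ᵐ[unitMeasure] ψ :=
  MemLp.coeFn_toLp _

theorem setIntegral_eq_inner (u : L2) {a b : ℝ} (ha : 0 ≤ a) (hb : b ≤ 1) {ψ : ℝ → ℝ}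
    (hψ : IsTest a b ψ) :
    ∫ x in Set.Ioo a b, u x * ψ x = inner ℝ u (contL2 ψ hψ.continuous) := by
  rw [inner_eq_integral_of_ae (Filter.EventuallyEq.refl _ _) (contL2_coe _)]
  refine (setIntegral_eq_of_subset_of_forall_sdiff_eq_zero measurableSet_Ioo
    (Set.Ioo_subset_Ioo ha hb) fun x hx => ?_).symm
  rw [hψ.eq_zero hx.2, mul_zero]

/-- The primitive of a test function of mean zero is a test function. -/
theorem IsTest.primitive {a b : ℝ} (hab : a < b) (ha : 0 ≤ a) {χ : ℝ → ℝ}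
    (hχ : IsTest a b χ) (h0 : ∫ x, χ x = 0) : IsTest a b (primitive χ) := by
  have hd : ∀ x, HasDerivAt (BrokenSpline.primitive χ) (χ x) x := fun x =>
    (hχ.continuous.integral_hasStrictDerivAt 0 x).hasDerivAt
  obtain ⟨a', b', ha', hb', hK⟩ := exists_Icc_of_isCompact_subset_Ioo hχ.hasCompactSupport hab
    hχ.tsupport_subset
  have hz : ∀ x, x ∉ Set.Icc a' b' → χ x = 0 := fun x hx =>
    image_eq_zero_of_notMem_tsupport fun h => hx (hK h)
  have hzero : ∀ x, x ∉ Set.Icc a' b' → BrokenSpline.primitive χ x = 0 := fun x hx => by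
    rcases lt_or_ge x a' with h | h
    · have h1 : ∀ t ∈ Set.uIcc 0 x, χ t = 0 := fun t ht => by
        refine hz t fun h' => ?_
        have := (Set.mem_uIcc.1 ht)
        rcases this with h2 | h2 <;> linarith [h'.1]
      rw [BrokenSpline.primitive, intervalIntegral.integral_congr h1]
      simp
    · have h2 : b' < x := not_le.1 fun h' => hx ⟨h, h'⟩
      rw [BrokenSpline.primitive, ← h0]
      refine intervalIntegral.integral_eq_integral_of_support_subset fun t ht => ?_
      have ht' := hK (subset_closure ht)
      exact ⟨by linarith [ht'.1], by linarith [ht'.2]⟩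
  refine ⟨contDiff_infty_iff_deriv.2 ⟨fun x => (hd x).differentiableAt, ?_⟩,
    HasCompactSupport.intro isCompact_Icc hzero, ?_⟩
  · have : _root_.deriv (BrokenSpline.primitive χ) = χ := funext fun x => (hd x).deriv
    rw [this]
    exact hχ.contDiff
  · refine (closure_minimal (Function.support_subset_iff'.2 hzero) isClosed_Icc).trans ?_
    exact Set.Icc_subset_Ioo ha' hb'

theorem IsWeakDeriv.congr {r : ℕ} {a b : ℝ} {f f' g g' : ℝ → ℝ} (h : IsWeakDeriv r a b f g)
    (hf : f =ᵐ[volume.restrict (Set.Ioo a b)] f') (hg : g =ᵐ[volume.restrict (Set.Ioo a b)] g') :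
    IsWeakDeriv r a b f' g' := by
  refine ⟨(memLp_congr_ae hg).1 h.1, fun φ h1 h2 h3 => ?_⟩
  have e1 := integral_congr_ae (hf.mul (Filter.EventuallyEq.refl _ (iteratedDeriv r φ)))
  have e2 := integral_congr_ae (hg.mul (Filter.EventuallyEq.refl _ φ))
  have e3 := h.2 φ h1 h2 h3
  simp only [Pi.mul_apply] at e1 e2
  rw [← e1, ← e2, e3]

theorem contL2_congr {ψ χ : ℝ → ℝ} (h : ψ = χ) (hψ : Continuous ψ) (hχ : Continuous χ) :
    contL2 ψ hψ = contL2 χ hχ := by subst h; rfl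

theorem integralOp_contL2 {χ : ℝ → ℝ} (hχ : Continuous χ) (h : Continuous (primitive χ)) :
    integralOp (contL2 χ hχ) = contL2 (primitive χ) h :=
  Lp.ext ((integralOp_coe_of_ae (contL2_coe hχ)).trans (contL2_coe h).symm)

theorem IsTest.inner_oneL2_contL2 {a b : ℝ} (ha : 0 ≤ a) (hb : b ≤ 1) {ψ : ℝ → ℝ}
    (hψ : IsTest a b ψ) :
    inner ℝ oneL2 (contL2 ψ hψ.continuous) = ∫ x, ψ x := by
  rw [inner_eq_integral_of_ae oneL2_coe (contL2_coe _)]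
  simp only [one_mul]
  refine setIntegral_eq_integral_of_forall_compl_eq_zero fun x hx => hψ.eq_zero fun h => hx ?_
  exact Set.Ioo_subset_Ioo ha hb h

theorem isWeakDeriv_coe_iff {r : ℕ} {a b : ℝ} (ha : 0 ≤ a) (hb : b ≤ 1) (f g : L2) :
    IsWeakDeriv r a b f g ↔ ∀ (φ : ℝ → ℝ) (hφ : IsTest a b φ),
      inner ℝ f (contL2 (iteratedDeriv r φ) (hφ.iteratedDeriv r).continuous) =
        (-1) ^ r * inner ℝ g (contL2 φ hφ.continuous) := by
  constructor
  · intro h φ hφ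
    rw [← setIntegral_eq_inner f ha hb (hφ.iteratedDeriv r), ← setIntegral_eq_inner g ha hb hφ]
    exact h.2 φ hφ.1 hφ.2 hφ.3
  · refine fun h => ⟨(Lp.memLp g).mono_measure
      (Measure.restrict_mono (Set.Ioo_subset_Ioo ha hb) le_rfl), fun φ h1 h2 h3 => ?_⟩
    have hφ : IsTest a b φ := ⟨h1, h2, h3⟩
    rw [setIntegral_eq_inner f ha hb (hφ.iteratedDeriv r), setIntegral_eq_inner g ha hb hφ]
    exact h φ hφ

/-- The lemma of du Bois-Reymond: if `g` is the weak derivative of order `r + 1` of `f`, then the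
one of order `r` is a primitive of `g`. Every test function `ψ` differs from a multiple of a fixed
one, `θ`, by the derivative of a test function. -/
theorem IsWeakDeriv.exists_integralOp {r : ℕ} {a b : ℝ} (hab : a < b) (ha : 0 ≤ a) (hb : b ≤ 1)
    {f g : L2} (h : IsWeakDeriv (r + 1) a b f g) :
    ∃ c : ℝ, IsWeakDeriv r a b f (integralOp g + c • oneL2 : L2) := by
  obtain ⟨θ, hθ, hθ1⟩ := exists_isTest_integral_eq_one hab
  rw [isWeakDeriv_coe_iff ha hb] at h
  set A := inner ℝ f (contL2 (iteratedDeriv r θ) (hθ.iteratedDeriv r).continuous)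
  set D := inner ℝ (integralOp g) (contL2 θ hθ.continuous)
  refine ⟨(-1) ^ r * A - D, (isWeakDeriv_coe_iff ha hb _ _).2 fun ψ hψ => ?_⟩
  set I := ∫ x, ψ x with hI
  have hχ : IsTest a b (ψ - I • θ) := hψ.sub (hθ.const_smul I)
  have hχ0 : ∫ x, (ψ - I • θ) x = 0 := by
    simp only [Pi.sub_apply, Pi.smul_apply, smul_eq_mul]
    rw [integral_sub, integral_const_mul, hθ1, mul_one, sub_self]
    · exact hψ.continuous.integrable_of_hasCompactSupport hψ.hasCompactSupport
    · exact (hθ.continuous.integrable_of_hasCompactSupport hθ.hasCompactSupport).const_mul I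
  have hφ := hχ.primitive hab ha hχ0
  set φ := BrokenSpline.primitive (ψ - I • θ)
  have hφ' : deriv φ = ψ - I • θ := funext fun x =>
    (hχ.continuous.integral_hasStrictDerivAt 0 x).hasDerivAt.deriv
  have hit : iteratedDeriv (r + 1) φ = iteratedDeriv r ψ - I • iteratedDeriv r θ := by
    rw [iteratedDeriv_succ', hφ']
    ext x
    rw [iteratedDeriv_sub, iteratedDeriv_const_smul_field, Pi.sub_apply, Pi.smul_apply]
    · exact hψ.contDiff.contDiffAt.of_le (by exact_mod_cast le_top)
    · exact (hθ.const_smul I).contDiff.contDiffAt.of_le (by exact_mod_cast le_top)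
  have e1 := h φ hφ
  rw [contL2_congr hit _ ((hψ.iteratedDeriv r).continuous.sub
    ((hθ.iteratedDeriv r).continuous.const_smul I))] at e1
  have e2 : contL2 (iteratedDeriv r ψ - I • iteratedDeriv r θ) ((hψ.iteratedDeriv r).continuous.sub
      ((hθ.iteratedDeriv r).continuous.const_smul I)) =
      contL2 (iteratedDeriv r ψ) (hψ.iteratedDeriv r).continuous
        - I • contL2 (iteratedDeriv r θ) (hθ.iteratedDeriv r).continuous := rfl
  have e3 : contL2 (ψ - I • θ) hχ.continuous = contL2 ψ hψ.continuous
      - I • contL2 θ hθ.continuous := rfl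
  have e4 := inner_integralOp_add g (contL2 (ψ - I • θ) hχ.continuous)
  rw [hχ.inner_oneL2_contL2 ha hb, hχ0, mul_zero, integralOp_contL2 hχ.continuous hφ.continuous, e3,
    inner_sub_right, inner_smul_right] at e4
  rw [e2, inner_sub_right, inner_smul_right] at e1
  rw [inner_add_left, inner_smul_left, hψ.inner_oneL2_contL2 ha hb, ← hI]
  have e5 : ((-1 : ℝ) ^ r) * (-1) ^ r = 1 := by rw [← mul_pow]; simp
  have e6 : inner ℝ g (contL2 φ hφ.continuous) =
      -(inner ℝ (integralOp g) (contL2 ψ hψ.continuous) - I * D) := by linarith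
  rw [e6, pow_succ] at e1
  simp only [conj_trivial]
  linear_combination e1 - I * A * e5

theorem iterate_integralOp_oneL2 (r : ℕ) :
    (integralOp ^ r) oneL2 =ᵐ[unitMeasure]
      fun x => (C ((r.factorial : ℝ)⁻¹) * X ^ r : ℝ[X]).eval x := by
  induction r with
  | zero => simpa using oneL2_coe
  | succ r ih =>
    rw [pow_succ', mul_apply_eq_comp]
    refine (integralOp_coe_of_ae ih).trans (.of_forall fun x => ?_)
    simp only [primitive, eval_mul, eval_C, eval_pow, eval_X, intervalIntegral.integral_const_mul,
      integral_pow, Nat.factorial_succ]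
    push_cast
    field_simp
    simp

/-- A function with a weak derivative `g` of order `r` is an `r`-fold primitive of `g`, up to a
polynomial. -/
theorem IsWeakDeriv.exists_polynomial {r : ℕ} {a b : ℝ} (hab : a < b) (ha : 0 ≤ a) (hb : b ≤ 1)
    {f g : L2} (h : IsWeakDeriv r a b f g) :
    ∃ Q : ℝ[X], Q.degree < r ∧
      f =ᵐ[volume.restrict (Set.Ioo a b)] fun x => (integralOp ^ r) g x + Q.eval x := by
  have hsub : Set.Ioo a b ⊆ Set.Ioo 0 1 := Set.Ioo_subset_Ioo ha hb
  induction r generalizing g with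
  | zero =>
    refine ⟨0, by simp, ?_⟩
    have hfi := (integrableOn_coe f).mono_set hsub
    have hgi := (integrableOn_coe g).mono_set hsub
    have h0 := IsOpen.ae_eq_zero_of_integral_contDiff_smul_eq_zero (μ := volume)
      (f := fun x => f x - g x) (isOpen_Ioo (a := a) (b := b))
      (hfi.sub hgi).locallyIntegrableOn fun φ h1 h2 h3 => by
        have hφ : IsTest a b φ := ⟨h1, h2, h3⟩
        have e := (isWeakDeriv_coe_iff ha hb f g).1 h φ hφ
        simp only [iteratedDeriv_zero, pow_zero, one_mul] at e
        rw [← sub_eq_zero, ← inner_sub_left, ← setIntegral_eq_inner (f - g) ha hb hφ] at e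
        rw [← e, ← setIntegral_eq_integral_of_forall_compl_eq_zero (s := Set.Ioo a b)
          fun x hx => by rw [hφ.eq_zero hx, zero_smul]]
        refine integral_congr_ae ?_
        filter_upwards [ae_restrict_of_ae_restrict_of_subset hsub (Lp.coeFn_sub f g)] with x hx
        rw [hx, smul_eq_mul, mul_comm, Pi.sub_apply]
    filter_upwards [ae_restrict_of_ae h0, ae_restrict_mem measurableSet_Ioo] with x hx hxm
    simpa [sub_eq_zero] using hx hxm
  | succ r ih =>
    obtain ⟨c, hc⟩ := h.exists_integralOp hab ha hb
    obtain ⟨Q, hQ, hfQ⟩ := ih hc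
    refine ⟨C (c * (r.factorial : ℝ)⁻¹) * X ^ r + Q, ?_, ?_⟩
    · refine (degree_add_le _ _).trans_lt (max_lt ?_ (hQ.trans ?_))
      · refine (degree_C_mul_X_pow_le _ _).trans_lt ?_
        exact_mod_cast Nat.lt_succ_self r
      · exact_mod_cast Nat.lt_succ_self r
    · have e : (integralOp ^ r) (integralOp g + c • oneL2) =
          (integralOp ^ (r + 1)) g + c • (integralOp ^ r) oneL2 := by
        rw [map_add, map_smul, pow_succ, mul_apply_eq_comp]
      rw [e] at hfQ
      filter_upwards [hfQ, ae_restrict_of_ae_restrict_of_subset hsub (iterate_integralOp_oneL2 r),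
        ae_restrict_of_ae_restrict_of_subset hsub
          (Lp.coeFn_add ((integralOp ^ (r + 1)) g) (c • (integralOp ^ r) oneL2)),
        ae_restrict_of_ae_restrict_of_subset hsub (Lp.coeFn_smul c ((integralOp ^ r) oneL2))]
        with x h1 h2 h3 h4
      rw [h1, h3, Pi.add_apply, h4, Pi.smul_apply, h2]
      simp only [eval_add, eval_mul, eval_C, eval_pow, eval_X, smul_eq_mul]
      ring

theorem exists_contDiffOn_iterate_integralOp (r : ℕ) (g : L2) :
    ∃ U : ℝ → ℝ, ContDiffOn ℝ r U (Set.Icc 0 1) ∧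
      (integralOp ^ (r + 1)) g =ᵐ[unitMeasure] U := by
  induction r with
  | zero =>
    exact ⟨primitive g, by simpa using continuousOn_primitive (integrableOn_coe g),
      by simpa using integralOp_coe g⟩
  | succ r ih =>
    obtain ⟨U, hU, hgU⟩ := ih
    refine ⟨primitive U, contDiffOn_primitive hU, ?_⟩
    rw [pow_succ', mul_apply_eq_comp]
    exact integralOp_coe_of_ae hgU

/-! ### The error of broken splines -/

section Pieces

variable {T : ℕ} (ξ : Breakpoints T)

theorem Breakpoints.pt_mem_Icc (i : Fin (T + 2)) : ξ.pt i ∈ Set.Icc (0 : ℝ) 1 := by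
  rw [← ξ.first, ← ξ.last]
  exact ⟨ξ.strictMono.monotone (Fin.zero_le i), ξ.strictMono.monotone (Fin.le_last i)⟩

theorem Breakpoints.pt_lt (i : Fin (T + 1)) : ξ.pt i.castSucc < ξ.pt i.succ :=
  ξ.strictMono Fin.castSucc_lt_succ

theorem Breakpoints.piece_subset (i : Fin (T + 1)) : ξ.piece i ⊆ Set.Ioo 0 1 :=
  Set.Ioo_subset_Ioo (ξ.pt_mem_Icc _).1 (ξ.pt_mem_Icc _).2

theorem Breakpoints.eq_of_mem_Ioc {i j : Fin (T + 1)} {x : ℝ}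
    (hi : x ∈ Set.Ioc (ξ.pt i.castSucc) (ξ.pt i.succ))
    (hj : x ∈ Set.Ioc (ξ.pt j.castSucc) (ξ.pt j.succ)) : i = j := by
  have h : ∀ {i j : Fin (T + 1)}, x ∈ Set.Ioc (ξ.pt i.castSucc) (ξ.pt i.succ) →
      x ∈ Set.Ioc (ξ.pt j.castSucc) (ξ.pt j.succ) → i ≤ j := fun hi hj =>
    Fin.castSucc_lt_succ_iff.1 (ξ.strictMono.lt_iff_lt.1 (hi.1.trans_le hj.2))
  exact le_antisymm (h hi hj) (h hj hi)

theorem Breakpoints.pairwise_disjoint_piece :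
    Pairwise (Function.onFun Disjoint ξ.piece) := fun _ _ hij =>
  Set.disjoint_left.2 fun _ hi hj =>
    hij (ξ.eq_of_mem_Ioc (Set.Ioo_subset_Ioc_self hi) (Set.Ioo_subset_Ioc_self hj))

theorem Breakpoints.ae_exists_mem_piece : ∀ᵐ x ∂unitMeasure, ∃ i, x ∈ ξ.piece i := by
  have hnull : ∀ᵐ x ∂unitMeasure, x ∉ Set.range ξ.pt :=
    ae_restrict_of_ae ((Set.finite_range ξ.pt).countable.ae_notMem volume)
  filter_upwards [ae_restrict_mem measurableSet_Ioo, hnull] with x hx hr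
  by_contra! hno
  have h : ∀ i : Fin (T + 2), ξ.pt i < x := by
    intro i
    induction i using Fin.induction with
    | zero => rw [ξ.first]; exact hx.1
    | succ i ih =>
      by_contra! hi
      exact hno i ⟨ih, lt_of_le_of_ne hi fun h => hr ⟨_, h.symm⟩⟩
  have := h (Fin.last (T + 1))
  rw [ξ.last] at this
  exact lt_asymm this hx.2

theorem Breakpoints.restrict_iUnion_piece :
    volume.restrict (⋃ i, ξ.piece i) = unitMeasure := by
  refine Measure.restrict_congr_set (Filter.EventuallyLE.antisymm
    (Set.iUnion_subset ξ.piece_subset).eventuallyLE ?_)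
  filter_upwards [(ae_restrict_iff' measurableSet_Ioo).1 ξ.ae_exists_mem_piece] with x hx h
  exact Set.mem_iUnion.2 (hx h)

/-- The pieces exhaust `(0,1)` up to a null set. -/
theorem Breakpoints.ae_of_forall_piece {P : ℝ → Prop}
    (h : ∀ i, ∀ᵐ x ∂volume.restrict (ξ.piece i), P x) : ∀ᵐ x ∂unitMeasure, P x := by
  rw [← ξ.restrict_iUnion_piece]
  exact (ae_restrict_iUnion_iff _ _).2 h

end Pieces

theorem toReal_eLpNorm_sq {μ : Measure ℝ} {g : ℝ → ℝ} (hg : MemLp g 2 μ) :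
    (eLpNorm g 2 μ).toReal ^ 2 = ∫ x, g x ^ 2 ∂μ := by
  rw [← Lp.norm_toLp g hg, ← real_inner_self_eq_norm_sq, L2.inner_def]
  refine integral_congr_ae ?_
  filter_upwards [hg.coeFn_toLp] with x hx
  rw [hx, sq]
  rfl

/-- The piecewise derivative is a single element of `L²(0,1)` whose norm is the broken norm. -/
theorem exists_L2_of_piecewise {T : ℕ} (ξ : Breakpoints T) {g : ℝ → ℝ}
    (hg : ∀ i, MemLp g 2 (volume.restrict (ξ.piece i))) :
    ∃ G : L2, G =ᵐ[unitMeasure] g ∧ ‖G‖ = brokenNorm ξ g := by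
  have hmeas : AEStronglyMeasurable g unitMeasure := by
    rw [← ξ.restrict_iUnion_piece]
    exact aestronglyMeasurable_iUnion_iff.2 fun i => (hg i).1
  have hint : ∀ i, IntegrableOn (fun x => g x ^ 2) (ξ.piece i) := fun i => (hg i).integrable_sq
  have hmem : MemLp g 2 unitMeasure := by
    rw [memLp_two_iff_integrable_sq hmeas, ← ξ.restrict_iUnion_piece]
    exact integrableOn_finite_iUnion.2 hint
  refine ⟨hmem.toLp g, hmem.coeFn_toLp, ?_⟩
  unfold brokenNorm
  rw [eq_comm, Real.sqrt_eq_iff_mul_self_eq (by positivity) (norm_nonneg _), ← sq, Lp.norm_toLp,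
    toReal_eLpNorm_sq hmem, ← ξ.restrict_iUnion_piece,
    integral_iUnion_fintype (s := ξ.piece) (fun _ => measurableSet_Ioo)
      ξ.pairwise_disjoint_piece hint]
  exact Finset.sum_congr rfl fun i _ => toReal_eLpNorm_sq (hg i)

/-- If `F` agrees almost everywhere with a continuous `D` near a breakpoint and with `U + q` on a
piece, then `q = D - U` on the piece, including its right end where this lies in the domain of
`D`. -/
theorem eqOn_Ioc_inter {a b c d : ℝ} (hcd : c < d) (hsub : Set.Ioo c d ⊆ Set.Ioo a b)
    {F D q U : ℝ → ℝ} (hD : ContinuousOn D (Set.Ioo a b)) (hU : ContinuousOn U (Set.Ioo a b))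
    (hq : Continuous q) (hFD : F =ᵐ[volume.restrict (Set.Ioo a b)] D)
    (hFq : F =ᵐ[volume.restrict (Set.Ioo c d)] fun x => U x + q x) :
    Set.EqOn q (fun x => D x - U x) (Set.Ioc c d ∩ Set.Ioo a b) := by
  have h1 : Set.EqOn q (fun x => D x - U x) (Set.Ioo c d) := by
    refine Measure.eqOn_open_of_ae_eq (μ := volume) ?_ isOpen_Ioo hq.continuousOn
      ((hD.sub hU).mono hsub)
    filter_upwards [ae_restrict_of_ae_restrict_of_subset hsub hFD, hFq] with x h1 h2
    rw [← h1, h2, add_sub_cancel_left]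
  refine h1.of_subset_closure hq.continuousOn ((hD.sub hU).mono Set.inter_subset_right)
    (fun x hx => ⟨Set.Ioo_subset_Ioc_self hx, hsub hx⟩) ?_
  rw [closure_Ioo hcd.ne]
  exact Set.inter_subset_left.trans Set.Ioc_subset_Icc_self

theorem exists_L2_of_memLp_Ioo {a b : ℝ} (ha : 0 ≤ a) (hb : b ≤ 1) {h : ℝ → ℝ}
    (hh : MemLp h 2 (volume.restrict (Set.Ioo a b))) :
    ∃ H : L2, H =ᵐ[volume.restrict (Set.Ioo a b)] h := by
  have hsub : Set.Ioo a b ⊆ Set.Ioo 0 1 := Set.Ioo_subset_Ioo ha hb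
  have hm : MemLp ((Set.Ioo a b).indicator h) 2 unitMeasure := by
    rw [memLp_indicator_iff_restrict measurableSet_Ioo, unitMeasure,
      Measure.restrict_restrict measurableSet_Ioo, Set.inter_eq_left.2 hsub]
    exact hh
  refine ⟨hm.toLp _, ?_⟩
  filter_upwards [ae_restrict_of_ae_restrict_of_subset hsub hm.coeFn_toLp,
    ae_restrict_mem measurableSet_Ioo] with x h1 h2
  rw [h1, Set.indicator_of_mem h2]

/-- The decomposition behind the upper bound: an element of the broken Sobolev space is the
`(p+1)`-fold primitive of its piecewise derivative plus a piecewise polynomial with the prescribed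
smoothness. -/
theorem sub_iterate_mem_classes_jumpFun {p T : ℕ} {ξ : Breakpoints T} {s : Fin T → ℤ}
    (hs : ∀ i, s i ≤ (p : ℤ) - 1) {f G : L2} (hf : f ∈ brokenSobolev p ξ s)
    (hG : IsBrokenDeriv (p + 1) ξ f G) :
    f - (integralOp ^ (p + 1)) G ∈ classes (jumpFun p ((p : ℤ) - 1) ξ s) := by
  have h1 := fun i => (hG i).exists_polynomial (ξ.pt_lt i) (ξ.pt_mem_Icc _).1 (ξ.pt_mem_Icc _).2
  choose Q hQ hfQ using h1
  obtain ⟨U, hU, hGU⟩ := exists_contDiffOn_iterate_integralOp p G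
  -- At a breakpoint, `j` takes the value of the polynomial to the left.
  set j : ℝ → ℝ := fun x =>
    ∑ i, (Set.Ioc (ξ.pt i.castSucc) (ξ.pt i.succ)).indicator (fun x => (Q i).eval x) x
  have hj : ∀ i, ∀ x ∈ Set.Ioc (ξ.pt i.castSucc) (ξ.pt i.succ), j x = (Q i).eval x := by
    intro i x hx
    refine (Finset.sum_eq_single i (fun k _ hk => ?_) (by simp)).trans
      (Set.indicator_of_mem hx _)
    exact Set.indicator_of_notMem (fun h => hk (ξ.eq_of_mem_Ioc h hx)) _
  have hfU : ∀ i, f =ᵐ[volume.restrict (ξ.piece i)] fun x => U x + (Q i).eval x := fun i => by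
    filter_upwards [hfQ i, ae_restrict_of_ae_restrict_of_subset (ξ.piece_subset i) hGU]
      with x h1 h2
    rw [h1, h2]
  refine ⟨j, ⟨fun i => ⟨Q i, ?_, fun x hx => hj i x (Set.Ioo_subset_Ioc_self hx)⟩,
    fun i h0 => ?_⟩, ?_⟩
  · exact natDegree_le_of_degree_le (Order.lt_succ_iff.1 (hQ i))
  · have hmin : min ((p : ℤ) - 1) (s i) = s i := min_eq_right (hs i)
    rw [hmin] at h0 ⊢
    obtain ⟨r, hr⟩ := Int.eq_ofNat_of_zero_le h0
    have hrp : r ≤ p := by have := hs i; omega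
    obtain ⟨h, hh⟩ := hf.2 i
    rw [hr, show ((r : ℤ) + 1).toNat = r + 1 by omega] at hh
    rw [hr, Int.toNat_natCast]
    have ha : 0 ≤ ξ.left i := (ξ.pt_mem_Icc _).1
    have hb : ξ.right i ≤ 1 := (ξ.pt_mem_Icc _).2
    have hlx : ξ.left i < ξ.interior i := ξ.pt_lt i.castSucc
    have hxr : ξ.interior i < ξ.right i := ξ.pt_lt i.succ
    have hsub : Set.Ioo (ξ.left i) (ξ.right i) ⊆ Set.Ioo 0 1 := Set.Ioo_subset_Ioo ha hb
    have hsub' := hsub.trans Set.Ioo_subset_Icc_self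
    obtain ⟨H, hH⟩ := exists_L2_of_memLp_Ioo ha hb hh.1
    obtain ⟨Q', -, hfQ'⟩ := (hh.congr (Filter.EventuallyEq.refl _ _) hH.symm).exists_polynomial
      (hlx.trans hxr) ha hb
    obtain ⟨U', hU', hHU'⟩ := exists_contDiffOn_iterate_integralOp r H
    set D : ℝ → ℝ := fun x => U' x + Q'.eval x
    have hQ'c : ContDiff ℝ r fun x => Q'.eval x := by simpa using Q'.contDiff_aeval (𝕜 := ℝ) r
    have hD : ContDiffOn ℝ r D (Set.Ioo (ξ.left i) (ξ.right i)) :=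
      (hU'.mono hsub').add hQ'c.contDiffOn
    have hUr : ContDiffOn ℝ r U (Set.Ioo (ξ.left i) (ξ.right i)) :=
      (hU.mono hsub').of_le (by exact_mod_cast hrp)
    have hfD : f =ᵐ[volume.restrict (Set.Ioo (ξ.left i) (ξ.right i))] D := by
      filter_upwards [hfQ', ae_restrict_of_ae_restrict_of_subset hsub hHU'] with x h1 h2
      rw [h1, h2]
    refine (hD.sub hUr).congr fun x hx => ?_
    rcases le_or_gt x (ξ.interior i) with h | h
    · have hx1 : x ∈ Set.Ioc (ξ.pt i.castSucc.castSucc) (ξ.pt i.castSucc.succ) := ⟨hx.1, h⟩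
      rw [hj _ x hx1]
      exact eqOn_Ioc_inter (ξ.pt_lt i.castSucc) (Set.Ioo_subset_Ioo_right hxr.le)
        hD.continuousOn hUr.continuousOn (Q _).continuous hfD (hfU i.castSucc) ⟨hx1, hx⟩
    · have hx1 : x ∈ Set.Ioc (ξ.pt i.succ.castSucc) (ξ.pt i.succ.succ) := ⟨h, hx.2.le⟩
      rw [hj _ x hx1]
      exact eqOn_Ioc_inter (ξ.pt_lt i.succ) (Set.Ioo_subset_Ioo_left hlx.le)
        hD.continuousOn hUr.continuousOn (Q _).continuous hfD (hfU i.succ) ⟨hx1, hx⟩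
  · refine (Lp.coeFn_sub _ _).trans (ξ.ae_of_forall_piece fun i => ?_)
    filter_upwards [hfQ i, ae_restrict_mem measurableSet_Ioo] with x h1 h2
    rw [Pi.sub_apply, h1, add_sub_cancel_left, hj i x (Set.Ioo_subset_Ioc_self h2)]

/-- With the maximal smoothness on `m` uniform segments, `(1 / (m π))^(p+1)` is an error constant,
whatever the breakpoints. -/
theorem pow_mem_admissible {p T : ℕ} (m : ℕ+) (ξ : Breakpoints T) {s : Fin T → ℤ}
    (hs : ∀ i, s i ≤ (p : ℤ) - 1) :
    (1 / (m * Real.pi)) ^ (p + 1) ∈ admissible p ((p : ℤ) - 1) m ξ s := by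
  intro f hf g hg
  obtain ⟨G, hGg, hGn⟩ := exists_L2_of_piecewise ξ fun i => (hg i).1
  have hG : IsBrokenDeriv (p + 1) ξ f G := fun i => (hg i).congr (Filter.EventuallyEq.refl _ _)
    (ae_restrict_of_ae_restrict_of_subset (ξ.piece_subset i) hGg.symm)
  set u := (integralOp ^ (p + 1)) G
  have hJ := sub_iterate_mem_classes_jumpFun hs hf hG
  have hP : (smoothSplines m p).starProjection u ∈ smoothSplines m p :=
    Submodule.starProjection_apply_mem _ _
  have hmem : (smoothSplines m p).starProjection u + (f - u) ∈ brokenSpline p ((p : ℤ) - 1) m ξ s :=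
    Submodule.add_mem_sup hP hJ
  refine (norm_projError_le _ f hmem).trans ?_
  rw [← hGn, show f - ((smoothSplines m p).starProjection u + (f - u)) =
    projError (smoothSplines m p) u by rw [projError_apply]; abel]
  exact norm_projError_smoothSplines_le m p G

theorem IsC.mono {k l : ℤ} (hkl : k ≤ l) {f : ℝ → ℝ} {U : Set ℝ} (h : IsC l f U) : IsC k f U :=
  fun hk => (h (hk.trans hkl)).of_le (by exact_mod_cast Int.toNat_le_toNat hkl)

theorem brokenSpline_anti {p T : ℕ} {k l : ℤ} (hkl : k ≤ l) (n : ℕ+) (ξ : Breakpoints T)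
    (s : Fin T → ℤ) : brokenSpline p l n ξ s ≤ brokenSpline p k n ξ s := by
  refine sup_le_sup ?_ ?_
  · rintro u ⟨f, hf, hu⟩
    exact ⟨f, ⟨hf.1.mono hkl, hf.2⟩, hu⟩
  · rintro u ⟨f, hf, hu⟩
    exact ⟨f, ⟨hf.1, fun i => (hf.2 i).mono (min_le_min_right _ hkl)⟩, hu⟩

theorem admissible_anti {p T : ℕ} {k l : ℤ} (hkl : k ≤ l) (n : ℕ+) (ξ : Breakpoints T)
    (s : Fin T → ℤ) : admissible p l n ξ s ⊆ admissible p k n ξ s := fun _ hC f hf g hg =>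
  (norm_projError_le _ f
    (brokenSpline_anti hkl n ξ s (Submodule.starProjection_apply_mem _ f))).trans (hC f hf g hg)

/-! ### The best polynomial approximation of `x ^ N` on an interval -/

theorem integral_sub_pow_mul_sub_pow (a b : ℝ) (i j : ℕ) :
    ∫ x in a..b, (x - a) ^ i * (b - x) ^ j =
      (i.factorial * j.factorial / (i + j + 1).factorial : ℝ) * (b - a) ^ (i + j + 1) := by
  induction j generalizing i with
  | zero =>
    have h : ∀ x, HasDerivAt (fun x : ℝ => (x - a) ^ (i + 1) / (i + 1)) ((x - a) ^ i) x :=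
        fun x => by
      have h := (((hasDerivAt_id x).sub_const a).pow (i + 1)).div_const ((i : ℝ) + 1)
      refine h.congr_deriv ?_
      simp only [id]
      push_cast
      field_simp
    simp only [pow_zero, mul_one]
    rw [intervalIntegral.integral_eq_sub_of_hasDerivAt (fun x _ => h x)
      (Continuous.intervalIntegrable (by fun_prop) _ _)]
    simp only [sub_self, Nat.factorial_zero, add_zero, Nat.factorial_succ]
    push_cast
    field_simp
    simp
  | succ j ih =>
    have h : ∀ x, HasDerivAt (fun x : ℝ => (x - a) ^ (i + 1) * (b - x) ^ (j + 1))
        (((i : ℝ) + 1) * ((x - a) ^ i * (b - x) ^ (j + 1))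
          - ((j : ℝ) + 1) * ((x - a) ^ (i + 1) * (b - x) ^ j)) x := fun x => by
      have h := (((hasDerivAt_id x).sub_const a).pow (i + 1)).mul
        (((hasDerivAt_id x).const_sub b).pow (j + 1))
      refine h.congr_deriv ?_
      simp only [id, Pi.pow_apply]
      push_cast
      ring
    have h1 := intervalIntegral.integral_eq_sub_of_hasDerivAt (a := a) (b := b) (fun x _ => h x)
      (Continuous.intervalIntegrable (by fun_prop) _ _)
    rw [intervalIntegral.integral_sub (Continuous.intervalIntegrable (by fun_prop) _ _)
      (Continuous.intervalIntegrable (by fun_prop) _ _), intervalIntegral.integral_const_mul,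
      intervalIntegral.integral_const_mul, ih] at h1
    simp only [sub_self, ne_eq, Nat.add_eq_zero_iff, one_ne_zero, and_false, not_false_eq_true,
      zero_pow, mul_zero, zero_mul] at h1
    have e1 : i + 1 + j + 1 = i + (j + 1) + 1 := by ring
    rw [e1] at h1
    have hi : ((i : ℝ) + 1) ≠ 0 := by positivity
    apply mul_left_cancel₀ hi
    rw [sub_eq_zero.1 h1, Nat.factorial_succ i, Nat.factorial_succ j]
    push_cast
    ring

/-- The polynomial `(X - a)^N (X - b)^N`, whose `N`-th derivative is, up to a factor, the Legendre
polynomial of `[a, b]`. -/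
def rodrigues (a b : ℝ) (N : ℕ) : ℝ[X] := (X - C a) ^ N * (X - C b) ^ N

theorem eval_iterate_derivative_eq_zero {A : ℝ[X]} {c : ℝ} {N i : ℕ} (h : (X - C c) ^ N ∣ A)
    (hi : i < N) : (derivative^[i] A).eval c = 0 := by
  have h1 := pow_sub_dvd_iterate_derivative_of_pow_dvd i h
  exact dvd_iff_isRoot.1 ((dvd_pow_self _ (by omega)).trans h1)

theorem integral_mul_iterate_derivative_rodrigues (a b : ℝ) {N r : ℕ} (hr : r ≤ N) (P : ℝ[X]) :
    ∫ x in a..b, P.eval x * (derivative^[r] (rodrigues a b N)).eval x =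
      (-1) ^ r * ∫ x in a..b, (derivative^[r] P).eval x * (rodrigues a b N).eval x := by
  induction r generalizing P with
  | zero => simp
  | succ r ih =>
    have h := intervalIntegral.integral_mul_deriv_eq_deriv_mul (a := a) (b := b)
      (fun x _ => P.hasDerivAt x)
      (fun x _ => (derivative^[r] (rodrigues a b N)).hasDerivAt x)
      ((derivative P).continuous.intervalIntegrable _ _)
      ((Polynomial.continuous _).intervalIntegrable _ _)
    rw [eval_iterate_derivative_eq_zero (A := rodrigues a b N) (Dvd.intro _ rfl) hr,
      eval_iterate_derivative_eq_zero (A := rodrigues a b N) (Dvd.intro_left _ rfl) hr,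
      ih (by omega)] at h
    simp only [Function.iterate_succ_apply'] at h ⊢
    rw [h, ← Function.iterate_succ_apply' derivative r P, Function.iterate_succ_apply]
    ring

theorem iterate_derivative_natDegree_of_monic {P : ℝ[X]} {d : ℕ} (hP : P.Monic)
    (hd : P.natDegree = d) : derivative^[d] P = C (d.factorial : ℝ) := by
  have h1 : derivative^[d] (P - X ^ d) = 0 := by
    refine iterate_derivative_eq_zero_of_degree_lt ?_
    have hdeg : P.degree = d := by rw [degree_eq_natDegree hP.ne_zero, hd]
    rw [← hdeg]
    exact degree_sub_lt_left (by rw [degree_X_pow, hdeg]) hP.ne_zero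
      (by rw [hP.leadingCoeff, (monic_X_pow d).leadingCoeff])
  rw [iterate_derivative_sub, sub_eq_zero] at h1
  rw [h1, iterate_derivative_X_pow_eq_C_mul]
  simp [Nat.descFactorial_self]

/-- The error of the best approximation of `x ^ N` by polynomials of lower degree on an interval of
length `h` is at least the norm of the monic Legendre polynomial. -/
theorem le_integral_pow_sub_sq {a b : ℝ} (hab : a ≤ b) {N : ℕ} {q : ℝ[X]} (hq : q.natDegree < N) :
    (N.factorial : ℝ) ^ 4 / ((2 * N).factorial * (2 * N + 1).factorial) * (b - a) ^ (2 * N + 1) ≤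
      ∫ x in a..b, (x ^ N - q.eval x) ^ 2 := by
  set A := rodrigues a b N with hA
  set L := derivative^[N] A with hL
  have hAm : A.Monic := ((monic_X_sub_C a).pow N).mul ((monic_X_sub_C b).pow N)
  have hAd : A.natDegree = N + N := by
    rw [hA, rodrigues, ((monic_X_sub_C a).pow N).natDegree_mul ((monic_X_sub_C b).pow N)]
    simp
  have hsgn : ((-1 : ℝ) ^ N) * (-1) ^ N = 1 := by rw [← mul_pow]; simp
  set β : ℝ := (N.factorial * N.factorial / (N + N + 1).factorial : ℝ) * (b - a) ^ (N + N + 1)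
    with hβ
  have hint : ∫ x in a..b, A.eval x = (-1) ^ N * β := by
    rw [hβ, ← integral_sub_pow_mul_sub_pow, ← intervalIntegral.integral_const_mul]
    refine intervalIntegral.integral_congr fun x _ => ?_
    simp only [hA, rodrigues, eval_mul, eval_pow, eval_sub, eval_X, eval_C]
    rw [← neg_sub b x, neg_pow (b - x)]
    ring
  have hconst : ∀ P : ℝ[X], ∀ c : ℝ, derivative^[N] P = C c →
      ∫ x in a..b, P.eval x * L.eval x = c * β := fun P c hP => by
    rw [hL, hA, integral_mul_iterate_derivative_rodrigues a b le_rfl, hP]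
    simp only [eval_C, intervalIntegral.integral_const_mul]
    rw [← hA, hint]
    linear_combination c * β * hsgn
  have h1 : ∫ x in a..b, (X ^ N - q).eval x * L.eval x = N.factorial * β := by
    refine hconst _ _ ?_
    rw [iterate_derivative_sub, iterate_derivative_eq_zero hq, sub_zero,
      iterate_derivative_X_pow_eq_C_mul]
    simp [Nat.descFactorial_self]
  have h2 : ∫ x in a..b, L.eval x * L.eval x = (2 * N).factorial * β := by
    refine hconst _ _ ?_
    rw [hL, ← Function.iterate_add_apply, iterate_derivative_natDegree_of_monic hAm hAd, two_mul]
  -- `c L` is the monic Legendre polynomial, so this is Pythagoras for `x ^ N - q = c L + …`.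
  set c : ℝ := N.factorial / (2 * N).factorial with hc
  have h3 : 0 ≤ ∫ x in a..b, ((X ^ N - q).eval x - c * L.eval x) ^ 2 :=
    intervalIntegral.integral_nonneg hab fun x _ => sq_nonneg _
  have h4 : ∫ x in a..b, ((X ^ N - q).eval x - c * L.eval x) ^ 2 =
      (∫ x in a..b, (x ^ N - q.eval x) ^ 2) - 2 * c * (∫ x in a..b, (X ^ N - q).eval x * L.eval x)
        + c ^ 2 * ∫ x in a..b, L.eval x * L.eval x := by
    rw [← intervalIntegral.integral_const_mul, ← intervalIntegral.integral_const_mul,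
      ← intervalIntegral.integral_sub, ← intervalIntegral.integral_add]
    · refine intervalIntegral.integral_congr fun x _ => ?_
      simp only [eval_sub, eval_pow, eval_X]
      ring
    all_goals exact Continuous.intervalIntegrable (by fun_prop) _ _
  rw [h4, h1, h2] at h3
  have h5 : (N.factorial : ℝ) ^ 4 / ((2 * N).factorial * (2 * N + 1).factorial)
      * (b - a) ^ (2 * N + 1) = 2 * c * (N.factorial * β) - c ^ 2 * ((2 * N).factorial * β) := by
    rw [hc, hβ, ← two_mul]
    have : ((2 * N).factorial : ℝ) ≠ 0 := by positivity
    field_simp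
    ring
  linarith

/-! ### The lower bound -/

/-- The power mean inequality for `k` parts of total length `s` and one part of length `t`. -/
theorem div_pow_le_add_div_pow {s t k : ℝ} (hs : 0 ≤ s) (ht : 0 ≤ t) (hk : 0 < k) (M : ℕ) :
    (s + t) ^ (M + 1) / (k + 1) ^ M ≤ s ^ (M + 1) / k ^ M + t ^ (M + 1) := by
  have h := (convexOn_pow (𝕜 := ℝ) (M + 1)).2
    (Set.mem_Ici.2 (by positivity : 0 ≤ s / k)) (Set.mem_Ici.2 ht)
    (by positivity : 0 ≤ k / (k + 1)) (by positivity : 0 ≤ 1 / (k + 1)) (by field_simp)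
  simp only [smul_eq_mul] at h
  have e1 : k / (k + 1) * (s / k) + 1 / (k + 1) * t = (s + t) / (k + 1) := by field_simp
  rw [e1, div_pow, div_pow] at h
  have h2 := mul_le_mul_of_nonneg_left h (by positivity : 0 ≤ k + 1)
  calc (s + t) ^ (M + 1) / (k + 1) ^ M = (k + 1) * ((s + t) ^ (M + 1) / (k + 1) ^ (M + 1)) := by
        field_simp
        ring
    _ ≤ _ := h2
    _ = _ := by
        field_simp
        ring

/-- A lower bound `c h^(M+1)` for the integral of `F` over all intervals of length `h` without a
point of `A` gives one for every interval: the points of `A` cut it into at most `|A| + 1` parts,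
and by the power mean inequality the sum of the bounds is smallest for parts of equal length. -/
theorem le_integral_of_forall_free {F : ℝ → ℝ} {c : ℝ} (hc : 0 ≤ c) (M : ℕ) (A : Finset ℝ)
    {a b : ℝ} (hab : a < b) (hF : IntervalIntegrable F volume a b)
    (h : ∀ u v, a ≤ u → u < v → v ≤ b → (∀ y ∈ A, y ∉ Set.Ioo u v) →
      c * (v - u) ^ (M + 1) ≤ ∫ x in u..v, F x) :
    c * ((b - a) ^ (M + 1) / ((A.card : ℝ) + 1) ^ M) ≤ ∫ x in a..b, F x := by
  induction A using Finset.induction_on_max generalizing a b with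
  | empty => simpa using h a b le_rfl hab le_rfl (by simp)
  | insert y A hy ih =>
    have hyA : y ∉ A := fun h' => lt_irrefl _ (hy y h')
    rw [Finset.card_insert_of_notMem hyA]
    push_cast
    by_cases hyab : y ∈ Set.Ioo a b
    · have h1 : IntervalIntegrable F volume a y := hF.mono_set
        (Set.uIcc_subset_uIcc_left (by
          rw [Set.uIcc_of_le hab.le]; exact Set.Ioo_subset_Icc_self hyab))
      have h2 : IntervalIntegrable F volume y b := hF.mono_set
        (Set.uIcc_subset_uIcc_right (by
          rw [Set.uIcc_of_le hab.le]; exact Set.Ioo_subset_Icc_self hyab))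
      have h3 := ih hyab.1 h1 fun u v hu huv hv hfree => h u v hu huv (hv.trans hyab.2.le) (by
        intro z hz
        rcases Finset.mem_insert.1 hz with rfl | hz
        · exact fun h' => absurd h'.2 (not_lt.2 hv)
        · exact hfree z hz)
      have h4 := h y b hyab.1.le hyab.2 le_rfl (by
        intro z hz
        rcases Finset.mem_insert.1 hz with rfl | hz
        · exact fun h' => lt_irrefl _ h'.1
        · exact fun h' => lt_asymm h'.1 (hy z hz))
      rw [← intervalIntegral.integral_add_adjacent_intervals h1 h2]
      have h5 := div_pow_le_add_div_pow (sub_nonneg.2 hyab.1.le) (sub_nonneg.2 hyab.2.le)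
        (by positivity : (0 : ℝ) < (A.card : ℝ) + 1) M
      have h6 := mul_le_mul_of_nonneg_left h5 hc
      rw [show y - a + (b - y) = b - a by ring] at h6
      linarith
    · refine le_trans ?_ (ih hab hF fun u v hu huv hv hfree => h u v hu huv hv (by
        intro z hz
        rcases Finset.mem_insert.1 hz with rfl | hz
        · exact fun h' => hyab ⟨hu.trans_lt h'.1, h'.2.trans_le hv⟩
        · exact hfree z hz))
      have := sub_pos.2 hab
      gcongr
      linarith

/-- The interior breakpoints of both the uniform partition and `ξ`. -/
def knots (n : ℕ+) {T : ℕ} (ξ : Breakpoints T) : Finset ℝ :=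
  ((Finset.Ioo 0 (n : ℕ)).image fun j : ℕ => (j : ℝ) / (n : ℝ)) ∪ Finset.univ.image ξ.interior

theorem card_knots_add_one_le (n : ℕ+) {T : ℕ} (ξ : Breakpoints T) :
    (knots n ξ).card + 1 ≤ n + T := by
  have h1 : ((Finset.Ioo 0 (n : ℕ)).image fun j : ℕ => (j : ℝ) / (n : ℝ)).card ≤ n - 1 := by
    simpa using Finset.card_image_le (s := Finset.Ioo 0 (n : ℕ))
      (f := fun j : ℕ => (j : ℝ) / (n : ℝ))
  have h2 : (Finset.univ.image ξ.interior).card ≤ T := by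
    simpa using Finset.card_image_le (s := Finset.univ) (f := ξ.interior)
  have h3 := Finset.card_union_le ((Finset.Ioo 0 (n : ℕ)).image fun j : ℕ => (j : ℝ) / (n : ℝ))
    (Finset.univ.image ξ.interior)
  have := n.pos
  unfold knots
  omega

theorem pt_mem_knots (n : ℕ+) {T : ℕ} (ξ : Breakpoints T) {i : Fin (T + 2)}
    (hi : ξ.pt i ∈ Set.Ioo (0 : ℝ) 1) : ξ.pt i ∈ knots n ξ := by
  refine Finset.mem_union_right _ (Finset.mem_image.2 ?_)
  induction i using Fin.lastCases with
  | last => exact absurd hi.2 (by rw [ξ.last]; exact lt_irrefl _)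
  | cast i =>
    induction i using Fin.cases with
    | zero =>
      have h0 : ξ.pt (Fin.castSucc 0) = 0 := ξ.first
      exact absurd hi.1 (by rw [h0]; exact lt_irrefl _)
    | succ i => exact ⟨i, Finset.mem_univ _, rfl⟩

theorem exists_subset_segment (n : ℕ+) {T : ℕ} (ξ : Breakpoints T) {u v : ℝ} (hu : 0 ≤ u)
    (huv : u < v) (hv : v ≤ 1) (hfree : ∀ y ∈ knots n ξ, y ∉ Set.Ioo u v) :
    ∃ j, Set.Ioo u v ⊆ segment n j := by
  have hn : (0 : ℝ) < (n : ℝ) := by exact_mod_cast n.pos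
  set c := (u + v) / 2 with hc
  have hc0 : 0 ≤ c * n := mul_nonneg (by linarith) hn.le
  have hjn : ⌊c * n⌋₊ < n := (Nat.floor_lt hc0).2 (by nlinarith)
  have h1 : (⌊c * n⌋₊ : ℝ) / n ≤ c := (div_le_iff₀ hn).2 (Nat.floor_le hc0)
  have h2 : c < ((⌊c * n⌋₊ : ℝ) + 1) / n := (lt_div_iff₀ hn).2 (Nat.lt_floor_add_one _)
  have hk : ∀ j : ℕ, (j : ℝ) / n ∉ Set.Ioo u v := fun j hj => by
    refine hfree _ (Finset.mem_union_left _
      (Finset.mem_image_of_mem _ (Finset.mem_Ioo.2 ⟨?_, ?_⟩))) hj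
    · have h := (div_pos_iff_of_pos_right hn).1 (hu.trans_lt hj.1)
      exact_mod_cast h
    · have h := (div_lt_one hn).1 (hj.2.trans_le hv)
      exact_mod_cast h
  refine ⟨⟨⌊c * n⌋₊, hjn⟩, fun x hx => ⟨?_, ?_⟩⟩
  · refine le_trans (le_of_not_gt fun h => hk ⌊c * n⌋₊ ⟨h, ?_⟩) hx.1.le
    linarith
  · refine hx.2.trans_le (le_of_not_gt fun h => hk (⌊c * n⌋₊ + 1) ⟨?_, ?_⟩)
    · push_cast; linarith
    · push_cast; exact h

theorem exists_subset_piece (n : ℕ+) {T : ℕ} (ξ : Breakpoints T) {u v : ℝ} (hu : 0 ≤ u)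
    (huv : u < v) (hv : v ≤ 1) (hfree : ∀ y ∈ knots n ξ, y ∉ Set.Ioo u v) :
    ∃ i, Set.Ioo u v ⊆ ξ.piece i := by
  have hk : ∀ i, ξ.pt i ≤ u ∨ v ≤ ξ.pt i := fun i => by
    by_contra! h
    exact hfree _ (pt_mem_knots n ξ ⟨hu.trans_lt h.1, h.2.trans_le hv⟩) h
  by_contra! hno
  have h : ∀ i : Fin (T + 2), ξ.pt i ≤ u := by
    intro i
    induction i using Fin.induction with
    | zero => rw [ξ.first]; exact hu
    | succ i ih =>
      exact (hk _).resolve_right fun h => hno i (Set.Ioo_subset_Ioo ih h)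
  have := h (Fin.last (T + 1))
  rw [ξ.last] at this
  linarith

/-- Between consecutive knots, elements of the broken spline space are polynomials. -/
theorem exists_polynomial_of_mem_brokenSpline {p : ℕ} {k : ℤ} {n : ℕ+} {T : ℕ} {ξ : Breakpoints T}
    {s : Fin T → ℤ} {w : L2} (hw : w ∈ brokenSpline p k n ξ s) {u v : ℝ} (hu : 0 ≤ u)
    (huv : u < v) (hv : v ≤ 1) (hfree : ∀ y ∈ knots n ξ, y ∉ Set.Ioo u v) :
    ∃ q : ℝ[X], q.natDegree ≤ p ∧ w =ᵐ[volume.restrict (Set.Ioo u v)] fun x => q.eval x := by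
  obtain ⟨w₁, ⟨f₁, hf₁, hw₁⟩, w₂, ⟨f₂, hf₂, hw₂⟩, rfl⟩ := Submodule.mem_sup.1 hw
  obtain ⟨j, hj⟩ := exists_subset_segment n ξ hu huv hv hfree
  obtain ⟨i, hi⟩ := exists_subset_piece n ξ hu huv hv hfree
  obtain ⟨P, hP, hPf⟩ := hf₁.2 j
  obtain ⟨Q, hQ, hQf⟩ := hf₂.1 i
  have hsub : Set.Ioo u v ⊆ Set.Ioo 0 1 := Set.Ioo_subset_Ioo hu hv
  refine ⟨P + Q, (natDegree_add_le _ _).trans (max_le hP hQ), ?_⟩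
  filter_upwards [ae_restrict_of_ae_restrict_of_subset hsub hw₁,
    ae_restrict_of_ae_restrict_of_subset hsub hw₂,
    ae_restrict_of_ae_restrict_of_subset hsub (Lp.coeFn_add w₁ w₂),
    ae_restrict_mem measurableSet_Ioo] with x h1 h2 h3 hx
  rw [h3, Pi.add_apply, h1, h2, hPf x (hj hx), hQf x (hi hx), eval_add]

theorem isWeakDeriv_polynomial {a b : ℝ} (hab : a ≤ b) (P : ℝ[X]) (r : ℕ) :
    IsWeakDeriv r a b (fun x => P.eval x) fun x => (derivative^[r] P).eval x := by
  refine ⟨?_, fun φ h1 h2 h3 => ?_⟩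
  · obtain ⟨C, hC⟩ := isCompact_Icc.exists_bound_of_continuousOn (s := Set.Icc a b)
      (derivative^[r] P).continuous.continuousOn
    refine MemLp.of_bound (derivative^[r] P).continuous.aestronglyMeasurable C ?_
    filter_upwards [ae_restrict_mem measurableSet_Ioo] with x hx
    exact hC x (Set.Ioo_subset_Icc_self hx)
  · have hφ : IsTest a b φ := ⟨h1, h2, h3⟩
    simp only [← integral_Ioc_eq_integral_Ioo, ← intervalIntegral.integral_of_le hab]
    induction r generalizing P with
    | zero => simp
    | succ r ih =>
      have hψ := hφ.iteratedDeriv r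
      have h := intervalIntegral.integral_mul_deriv_eq_deriv_mul (a := a) (b := b)
        (fun x _ => P.hasDerivAt x)
        (fun x _ => (hψ.contDiff.differentiable (by simp) x).hasDerivAt)
        ((derivative P).continuous.intervalIntegrable _ _)
        (hψ.deriv.continuous.intervalIntegrable _ _)
      rw [hψ.eq_zero (by simp), hψ.eq_zero (by simp), ih] at h
      rw [iteratedDeriv_succ, h, Function.iterate_succ_apply]
      ring

/-- The class of `x ^ N` in `L²(0,1)`. -/
abbrev powL2 (N : ℕ) : L2 := contL2 (fun x => (X ^ N : ℝ[X]).eval x) (X ^ N : ℝ[X]).continuous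

theorem isWeakDeriv_powL2 {a b : ℝ} (ha : 0 ≤ a) (hab : a ≤ b) (hb : b ≤ 1) (N r : ℕ) :
    IsWeakDeriv r a b (powL2 N) fun x => (derivative^[r] (X ^ N : ℝ[X])).eval x :=
  (isWeakDeriv_polynomial hab (X ^ N) r).congr
    (ae_restrict_of_ae_restrict_of_subset (Set.Ioo_subset_Ioo ha hb) (contL2_coe _).symm)
    (Filter.EventuallyEq.refl _ _)

/-- Every error constant is at least the one obtained from `x ^ (p+1)`. -/
theorem le_of_mem_admissible {p : ℕ} {k : ℤ} {n : ℕ+} {T : ℕ} {ξ : Breakpoints T}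
    {s : Fin T → ℤ} {c : ℝ} (hc : c ∈ admissible p k n ξ s) :
    (p + 1).factorial / √((2 * (p + 1)).factorial * (2 * (p + 1) + 1).factorial)
      * (1 / ((n : ℝ) + T)) ^ (p + 1) ≤ c := by
  set N := p + 1 with hN
  have hD : IsBrokenDeriv N ξ (powL2 N) fun _ => (N.factorial : ℝ) := fun i => by
    have h := isWeakDeriv_powL2 (ξ.pt_mem_Icc i.castSucc).1 (ξ.pt_lt i).le (ξ.pt_mem_Icc i.succ).2
      N N
    simpa [iterate_derivative_X_pow_eq_C_mul, Nat.descFactorial_self] using h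
  have hf : powL2 N ∈ brokenSobolev p ξ s := by
    refine ⟨fun i => ⟨_, hD i⟩, fun i => ⟨_, isWeakDeriv_powL2 (ξ.pt_mem_Icc _).1 ?_
      (ξ.pt_mem_Icc _).2 _ _⟩⟩
    exact ((ξ.pt_lt i.castSucc).trans (ξ.pt_lt i.succ)).le
  have hnorm : brokenNorm ξ (fun _ => (N.factorial : ℝ)) = N.factorial := by
    obtain ⟨G, hG, hGn⟩ := exists_L2_of_piecewise ξ fun i => (hD i).1
    rw [← hGn, ← sq_eq_sq₀ (norm_nonneg _) (by positivity), norm_sq_eq_intervalIntegral hG]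
    simp
  have h1 := hc _ hf _ hD
  rw [hnorm] at h1
  set w := brokenProj p k n ξ s (powL2 N)
  have hw : w ∈ brokenSpline p k n ξ s := Submodule.starProjection_apply_mem _ _
  have hn : (0 : ℝ) < (n : ℝ) := by exact_mod_cast n.pos
  set κ : ℝ := (N.factorial : ℝ) ^ 4 / ((2 * N).factorial * (2 * N + 1).factorial) with hκ
  have h2 : κ * ((1 - 0 : ℝ) ^ (2 * N + 1) / (((knots n ξ).card : ℝ) + 1) ^ (2 * N)) ≤
      ∫ x in (0 : ℝ)..1, (powL2 N - w : L2) x ^ 2 := by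
    refine le_integral_of_forall_free (by positivity) (2 * N) (knots n ξ) zero_lt_one
      (intervalIntegrable_coe_sq _ (by simp) (by simp)) fun u v hu huv hv hfree => ?_
    obtain ⟨q, hq, hwq⟩ := exists_polynomial_of_mem_brokenSpline hw hu huv hv hfree
    refine (le_integral_pow_sub_sq huv.le (Nat.lt_succ_of_le hq)).trans_eq ?_
    refine integral_congr_of_ae_Ioo huv.le ?_
    have hsub : Set.Ioo u v ⊆ Set.Ioo 0 1 := Set.Ioo_subset_Ioo hu hv
    filter_upwards [hwq, ae_restrict_of_ae_restrict_of_subset hsub (Lp.coeFn_sub (powL2 N) w),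
      ae_restrict_of_ae_restrict_of_subset hsub (contL2_coe (X ^ N : ℝ[X]).continuous)]
      with x h1 h2 h3
    rw [h2, Pi.sub_apply, h1, h3, eval_pow, eval_X]
  rw [← norm_sq_eq_intervalIntegral (Filter.EventuallyEq.refl _ _)] at h2
  have h3 : ((knots n ξ).card : ℝ) + 1 ≤ n + T := by exact_mod_cast card_knots_add_one_le n ξ
  have h4 : (N.factorial / √((2 * N).factorial * (2 * N + 1).factorial)
      * (1 / ((n : ℝ) + T)) ^ N * N.factorial) ^ 2 ≤ ‖powL2 N - w‖ ^ 2 := by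
    refine le_trans ?_ h2
    calc _ = κ * (1 / ((n : ℝ) + T) ^ (2 * N)) := by
          rw [hκ, mul_pow, mul_pow, div_pow, Real.sq_sqrt (by positivity), one_div_pow, one_div_pow,
            ← pow_mul, mul_comm N 2]
          ring
      _ ≤ _ := by
          rw [sub_zero, one_pow]
          gcongr
  have h5 := (abs_le_of_sq_le_sq' h4 (norm_nonneg _)).2.trans h1
  exact le_of_mul_le_mul_right h5 (by positivity)

/-! ### Comparison of the constants -/

theorem isLeast_brokenConst {p : ℕ} {k : ℤ} {n : ℕ+} {T : ℕ} {ξ : Breakpoints T} {s : Fin T → ℤ}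
    (h : (admissible p k n ξ s).Nonempty) :
    IsLeast (admissible p k n ξ s) (brokenConst p k n ξ s) := by
  have hb : BddBelow (admissible p k n ξ s) := ⟨_, fun _ hc => le_of_mem_admissible hc⟩
  refine ⟨fun f hf g hg => ?_, fun c hc => csInf_le hb hc⟩
  have hnn : 0 ≤ brokenNorm ξ g := Real.sqrt_nonneg _
  rcases hnn.eq_or_lt with h0 | h0
  · obtain ⟨c, hc⟩ := h
    have := hc f hf g hg
    rwa [← h0, mul_zero] at this ⊢
  · rw [← div_le_iff₀ h0]
    exact le_csInf h fun c hc => (div_le_iff₀ h0).2 (hc f hf g hg)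

/-- Stirling's estimate, from the monotonicity of `n! / (√(2n) (n/e)^n)`. -/
theorem factorial_two_mul_le {N : ℕ} (hN : 0 < N) :
    ((2 * N).factorial : ℝ) ≤ N.factorial * (√2 * (4 * N / Real.exp 1) ^ N) := by
  have h : Stirling.stirlingSeq (2 * N) ≤ Stirling.stirlingSeq N := by
    obtain ⟨M, rfl⟩ : ∃ M, N = M + 1 := ⟨N - 1, by omega⟩
    have := Stirling.stirlingSeq'_antitone (show M ≤ 2 * M + 1 by omega)
    simpa [Function.comp_def, Nat.succ_eq_add_one, mul_add] using this
  have hN' : (0 : ℝ) < N := by exact_mod_cast hN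
  have he := Real.exp_pos 1
  unfold Stirling.stirlingSeq at h
  push_cast at h
  rw [div_le_iff₀ (by positivity)] at h
  refine h.trans_eq ?_
  have h1 : √(2 * (2 * (N : ℝ))) = √2 * √(2 * N) := Real.sqrt_mul (by norm_num) _
  have h2 : (2 * (N : ℝ) / Real.exp 1) ^ (2 * N) =
      (4 * N / Real.exp 1) ^ N * (N / Real.exp 1) ^ N := by
    rw [pow_mul, ← mul_pow]
    congr 1
    ring
  rw [h1, h2]
  have : 0 < √(2 * (N : ℝ)) := by positivity
  field_simp

/-- The upper bound for `m` segments with maximal smoothness is below the lower bound for `N'`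
pieces as soon as `N' / m` is small enough. -/
theorem pow_lt_of_lt_one {p : ℕ} {m N' : ℝ} (hm : 0 < m) (hN' : 0 < N')
    (h : (4 / (Real.exp 1 * Real.pi) * (N' * (p + 1) / m)) ^ (p + 1) * √(4 * (p : ℝ) + 6) < 1) :
    (1 / (m * Real.pi)) ^ (p + 1) <
      (p + 1).factorial / √((2 * (p + 1)).factorial * (2 * (p + 1) + 1).factorial)
        * (1 / N') ^ (p + 1) := by
  have hpi := Real.pi_pos
  have he := Real.exp_pos 1
  set N := p + 1 with hN
  have hNr : ((p : ℝ) + 1) = N := by rw [hN]; push_cast; ring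
  have hst := factorial_two_mul_le (N := N) (by omega)
  have hf : (0 : ℝ) < (2 * N).factorial := by positivity
  have hsq : √((2 * N).factorial * (2 * N + 1).factorial : ℝ) =
      (2 * N).factorial * √(2 * N + 1) := by
    rw [Nat.factorial_succ, ← Real.sqrt_sq hf.le, ← Real.sqrt_mul (sq_nonneg _),
      Real.sqrt_sq hf.le]
    congr 1
    push_cast
    ring
  have h6 : √(4 * (p : ℝ) + 6) = √2 * √(2 * N + 1) := by
    rw [← Real.sqrt_mul (by norm_num), ← hNr]
    congr 1
    ring
  rw [hNr, h6] at h
  rw [hsq, div_mul_eq_mul_div, lt_div_iff₀ (by positivity)]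
  have hS : 0 < √(2 * (N : ℝ) + 1) := by positivity
  calc (1 / (m * Real.pi)) ^ N * ((2 * N).factorial * √(2 * N + 1))
      ≤ (1 / (m * Real.pi)) ^ N *
        (N.factorial * (√2 * (4 * N / Real.exp 1) ^ N) * √(2 * N + 1)) := by gcongr
    _ = N.factorial * (1 / N') ^ N *
        ((4 / (Real.exp 1 * Real.pi) * (N' * N / m)) ^ N * (√2 * √(2 * N + 1))) := by
      have e : (4 / (Real.exp 1 * Real.pi) * (N' * N / m)) ^ N =
          (1 / (m * Real.pi)) ^ N * (4 * N / Real.exp 1) ^ N * N' ^ N := by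
        rw [← mul_pow, ← mul_pow]
        congr 1
        field_simp
      have e' : (1 / N') ^ N * N' ^ N = 1 := by
        rw [← mul_pow, one_div_mul_cancel hN'.ne', one_pow]
      rw [e]
      linear_combination (-(1 / (m * Real.pi)) ^ N * N.factorial * √2 *
        (4 * N / Real.exp 1) ^ N * √(2 * N + 1)) * e'
    _ < N.factorial * (1 / N') ^ N * 1 := by gcongr
    _ = _ := mul_one _

end BrokenSpline

end

theorem mainTheorem7 (p : ℕ) (k : ℤ) (hk : -1 ≤ k) (hkp : k < (p : ℤ) - 1)
    (T : ℕ) (ξ : BrokenSpline.Breakpoints T) (s : Fin T → ℤ)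
    (hs : ∀ i, -1 ≤ s i ∧ s i ≤ (p : ℤ) - 1)
    (nbar : ℕ+) (hR : BrokenSpline.R p k nbar < 1)
    (n : ℕ+)
    (hn : (1 + ((T : ℝ) * ((p : ℝ) - k) - (BrokenSpline.excess p k n ξ s : ℝ))
        / ((p : ℝ) - k - 1)) * (nbar : ℝ) - T ≤ (n : ℝ)) :
    ∃ m : ℕ+, (m : ℤ) = BrokenSpline.smoothSegments p k n ξ s ∧
      IsLeast (BrokenSpline.admissible p ((p : ℤ) - 1) m ξ s)
        (BrokenSpline.brokenConst p ((p : ℤ) - 1) m ξ s) ∧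
      IsLeast (BrokenSpline.admissible p k n ξ s) (BrokenSpline.brokenConst p k n ξ s) ∧
      BrokenSpline.brokenConst p ((p : ℤ) - 1) m ξ s < BrokenSpline.brokenConst p k n ξ s := by
  have hs' : ∀ i, s i ≤ (p : ℤ) - 1 := fun i => (hs i).2
  have hq : 0 < (p : ℝ) - k - 1 := by
    have h : (k : ℝ) < (p : ℝ) - 1 := by exact_mod_cast hkp
    linarith
  have hn1 : (1 : ℝ) ≤ n := by exact_mod_cast n.pos
  have hb1 : (1 : ℝ) ≤ nbar := by exact_mod_cast nbar.pos
  set M := BrokenSpline.smoothSegments p k n ξ s with hM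
  have hMr : (M : ℝ) = ((n : ℝ) - 1) * ((p : ℝ) - k) + 1 + (BrokenSpline.excess p k n ξ s : ℝ) := by
    rw [hM, BrokenSpline.smoothSegments]
    push_cast
    ring
  have hA : 0 < ((p : ℝ) - k) * ((nbar : ℝ) - 1) + 1 := by
    have : 0 ≤ ((p : ℝ) - k) * ((nbar : ℝ) - 1) := mul_nonneg (by linarith) (by linarith)
    linarith
  -- The hypothesis on `n` says that `(n + T) / M` is at most the ratio in `B p k nbar`.
  have hratio : ((n : ℝ) + T) * (((p : ℝ) - k) * ((nbar : ℝ) - 1) + 1) ≤ nbar * M := by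
    have h1 : ((p : ℝ) - k - 1 + ((T : ℝ) * ((p : ℝ) - k) - (BrokenSpline.excess p k n ξ s : ℝ)))
        * nbar ≤ ((n : ℝ) + T) * ((p : ℝ) - k - 1) := by
      have h2 := mul_le_mul_of_nonneg_right (sub_le_iff_le_add.1 hn) hq.le
      refine le_trans (le_of_eq ?_) h2
      field_simp
    rw [hMr]
    nlinarith
  have hT : (0 : ℝ) ≤ T := Nat.cast_nonneg T
  have hMpos : (0 : ℝ) < M := by
    have h1 : 0 < (nbar : ℝ) * M := lt_of_lt_of_le (mul_pos (by linarith) hA) hratio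
    exact (mul_pos_iff_of_pos_left (by linarith)).1 h1
  have hMpos' : 0 < M := by exact_mod_cast hMpos
  obtain ⟨m, hm⟩ := Int.eq_ofNat_of_zero_le hMpos'.le
  have hm0 : 0 < m := by omega
  have hmr : (M : ℝ) = m := by rw [hm]; simp
  have hsmooth := BrokenSpline.pow_mem_admissible ⟨m, hm0⟩ ξ hs'
  have hrough := BrokenSpline.admissible_anti hkp.le n ξ s
    (BrokenSpline.pow_mem_admissible n ξ hs')
  have hleast := BrokenSpline.isLeast_brokenConst ⟨_, hsmooth⟩
  have hleast' := BrokenSpline.isLeast_brokenConst ⟨_, hrough⟩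
  refine ⟨⟨m, hm0⟩, hm.symm, hleast, hleast', ?_⟩
  have hupper := hleast.2 hsmooth
  have hlower := BrokenSpline.le_of_mem_admissible hleast'.1
  refine (hupper.trans_lt ?_).trans_le hlower
  refine BrokenSpline.pow_lt_of_lt_one (by exact_mod_cast hm0) (by linarith) (lt_of_le_of_lt ?_ hR)
  have hpi := Real.pi_pos
  unfold BrokenSpline.R BrokenSpline.B
  have hfrac : ((n : ℝ) + T) * ((p : ℝ) + 1) / m ≤
      nbar * ((p : ℝ) + 1) / (((p : ℝ) - k) * ((nbar : ℝ) - 1) + 1) := by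
    rw [hmr] at hratio hMpos
    rw [div_le_div_iff₀ hMpos hA]
    have := mul_le_mul_of_nonneg_right hratio (by positivity : (0 : ℝ) ≤ (p : ℝ) + 1)
    linarith
  have h0 : 0 ≤ ((n : ℝ) + T) * ((p : ℝ) + 1) / m := by positivity
  refine mul_le_mul_of_nonneg_right (pow_le_pow_left₀ (by positivity) ?_ _) (Real.sqrt_nonneg _)
  exact mul_le_mul_of_nonneg_left hfrac (by positivity)
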